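/- **Setting.** Let $\mathscr I=\mathbb R\times S^2$ with coordinates $(u,\hat r)$ and volume element $\epsilon_{\mathscr I}=du\wedge\sin\theta\,d\theta\wedge d\phi$, let $\eth,\bar\eth$ be the spin-weighted derivatives of the unit round sphere (the covariant derivatives along $m,\bar m$, with $m\cdot\bar m=1$), and let $\mathcal E=\eth^2C^\infty(S^2,\mathbb R)$ be the space of purely electric smooth spin-weight-2 functions on $S^2$. Fix $\varepsilon>0$. Let $\mathcal F_0$ be the real vector space of smooth complex spin-weight-2 functions $f$ on $\mathscr I$ such that $\sup_{\mathscr I}|(1+u^2)^{k/2+\varepsilon}\partial_u^k\mathscr D f|<\infty$ for all $k\ge1$ and all finite words $\mathscr D$ in $\eth,\bar\eth$, and such that the limits $f_\pm=\lim_{u\to\pm\infty}f$ belong to $\mathcal E$; let $\mathcal F_1=\partial_u\mathcal F_0$. These spaces carry their Fréchet topologies (seminorms $\sup|\mathscr D f|$ on $\mathcal E$; $\sup|\mathscr D f_-|$ and $\sup|(1+u^2)^{k/2+\varepsilon}\partial_u^k\mathscr D f|$, $k\ge1$, on $\mathcal F_0$; $\sup|(1+u^2)^{k/2+1/2+\varepsilon}\partial_u^k\mathscr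 D g|$, $k\ge0$, on $\mathcal F_1$), and smoothness of maps between them is meant in the sense of Fréchet calculus. The kinematical phase space is $\mathcal P=\mathcal F_0\times\mathcal F_1\ni(\sigma,\bar N)$ with symplectic form $\Omega=\frac1{4\pi}\mathrm{Re}\int\epsilon_{\mathscr I}\,\delta N\,\delta\sigma$ (wedge product implicit), and the constrained phase space is $\mathcal P_K=\{(\sigma,\bar N)\in\mathcal P:\bar N+\partial_u\sigma=0\}$; equality on $\mathcal P_K$ ("on-shell") is written $\doteq$. A function $F:\mathcal P\to\mathbb R$ is *regular* if $\delta F=-I_{X_F}\Omega$ for some smooth vector field $X_F$ on $\mathcal P$; for regular $F,G$ put $\{F,G\}=-\Omega(X_F,X_G)$. Let $K_\varphi=\frac1{4\pi}\mathrm{Re}\int\epsilon_{\mathscr I}\,\bar\varphi(\bar N+\partial_u\sigma)$, and let $\mathcal K$ be the space of smooth spin-weight-2 functions $\varphi$ on $\mathscr I$ for which $K_\varphi$ is well defined and regular on $\mathcal P$. A *proper observable* is a smooth function $F:\mathcal P\to\mathbb R$ that is regular and *tangentially extensible*: there is a (possibly field-dependent) $\varphi_F$ with values in $\mathcal K$ such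 that $\{K_{\varphi_F},K_{\varphi'}\}\doteq-\{F,K_{\varphi'}\}$ for all $\varphi'\in\mathcal K$. **Theorem 1.** (i) Let $\Theta:\mathcal E\times\mathcal E\to\mathbb R$ be a smooth functional, and suppose that some proper observable $F$ satisfies $F(\sigma,\bar N)=\Theta(\sigma_+,\sigma_-)$ for all $(\sigma,\bar N)\in\mathcal P_K$. Then $\Theta$ is a functional of the memory mode alone: there is a smooth $\vartheta:\mathcal E\to\mathbb R$ with $\Theta(a,b)=\vartheta(a-b)$ for all $a,b\in\mathcal E$. (ii) Consequently the Goldstone mode $\sigma_++\sigma_-$ cannot be directly measured by any proper observable: if $G:\mathcal E\to\mathbb R$ is a functional and some proper observable $F$ satisfies $F(\sigma,\bar N)=G(\sigma_++\sigma_-)$ for all $(\sigma,\bar N)\in\mathcal P_K$, then $G$ is constant. -/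

import Mathlib

open scoped ContDiff Topology
open Filter MeasureTheory

noncomputable section

namespace AS

/-! ## Smooth maps between topological vector spaces -/

/-- `w` is the directional derivative of `f` at `x` in the direction `v`. -/
def HasDirDeriv {V W : Type} [AddCommGroup V] [Module ℝ V]
    [AddCommGroup W] [Module ℝ W] [TopologicalSpace W] (f : V → W) (x v : V) (w : W) : Prop :=
  Tendsto (fun t : ℝ => t⁻¹ • (f (x + t • v) - f x)) (𝓝[≠] 0) (𝓝 w)

/-- `f` is of class `C^n` in the sense of Michal and Bastiani: it is continuous and, if `n > 0`, all
its directional derivatives exist and `(x, v) ↦ df(x; v)` is of class `C^(n-1)`. -/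
def IsCn {W : Type} [AddCommGroup W] [Module ℝ W] [TopologicalSpace W] :
    ℕ → ∀ {V : Type} [AddCommGroup V] [Module ℝ V] [TopologicalSpace V], (V → W) → Prop
  | 0, _, _, _, _, f => Continuous f
  | n + 1, V, _, _, _, f => Continuous f ∧
      ∃ f' : V × V → W, (∀ x v, HasDirDeriv f x v (f' (x, v))) ∧ IsCn n f'

/-- Smooth (`C^∞`) maps; for Fréchet spaces this is the usual notion. -/
def IsSmooth {V W : Type} [AddCommGroup V] [Module ℝ V] [TopologicalSpace V]
    [AddCommGroup W] [Module ℝ W] [TopologicalSpace W] (f : V → W) : Prop :=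
  ∀ n, IsCn n f

/-! ## Frames on the round sphere, spin-weighted functions and the eth operators

An element of `SO3` is an oriented orthonormal frame of the unit sphere: its columns are
`e₁, e₂, r` with `r` the point of the sphere and `e₁, e₂` tangent at `r`; the associated complex
null vector is `m = (e₁ - i e₂) / √2`.  A spin-weighted function is a function of the frame with
the prescribed behaviour under `m ↦ exp(iψ) m`. -/

/-- Oriented orthonormal frames of the round sphere. -/
abbrev SO3 : Type := Matrix.specialOrthogonalGroup (Fin 3) ℝ

theorem rotZ_mem (t : ℝ) : (!![Real.cos t, -Real.sin t, 0; Real.sin t, Real.cos t, 0; 0, 0, 1] :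
    Matrix (Fin 3) (Fin 3) ℝ) ∈ Matrix.specialOrthogonalGroup (Fin 3) ℝ := by
  have h := Real.sin_sq_add_cos_sq t
  rw [Matrix.mem_specialOrthogonalGroup_iff, Matrix.mem_orthogonalGroup_iff]
  refine ⟨?_, ?_⟩
  · ext i j
    fin_cases i <;> fin_cases j <;>
      simp [Matrix.mul_apply, Fin.sum_univ_three] <;> nlinarith
  · simp [Matrix.det_fin_three]; nlinarith

theorem rotY_mem (t : ℝ) : (!![Real.cos t, 0, Real.sin t; 0, 1, 0; -Real.sin t, 0, Real.cos t] :
    Matrix (Fin 3) (Fin 3) ℝ) ∈ Matrix.specialOrthogonalGroup (Fin 3) ℝ := by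
  have h := Real.sin_sq_add_cos_sq t
  rw [Matrix.mem_specialOrthogonalGroup_iff, Matrix.mem_orthogonalGroup_iff]
  refine ⟨?_, ?_⟩
  · ext i j
    fin_cases i <;> fin_cases j <;>
      simp [Matrix.mul_apply, Fin.sum_univ_three] <;> nlinarith
  · simp [Matrix.det_fin_three]; nlinarith

theorem rotX_mem (t : ℝ) : (!![1, 0, 0; 0, Real.cos t, Real.sin t; 0, -Real.sin t, Real.cos t] :
    Matrix (Fin 3) (Fin 3) ℝ) ∈ Matrix.specialOrthogonalGroup (Fin 3) ℝ := by
  have h := Real.sin_sq_add_cos_sq t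
  rw [Matrix.mem_specialOrthogonalGroup_iff, Matrix.mem_orthogonalGroup_iff]
  refine ⟨?_, ?_⟩
  · ext i j
    fin_cases i <;> fin_cases j <;>
      simp [Matrix.mul_apply, Fin.sum_univ_three] <;> nlinarith
  · simp [Matrix.det_fin_three]; nlinarith

/-- `R * rotZ ψ` is the frame `R` with `m` replaced by `exp(iψ) m`. -/
def rotZ (t : ℝ) : SO3 := ⟨_, rotZ_mem t⟩

/-- `R * rotY t` is the frame `R` parallelly transported by `t` along the geodesic towards `e₁`. -/
def rotY (t : ℝ) : SO3 := ⟨_, rotY_mem t⟩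

/-- `R * rotX t` is the frame `R` parallelly transported by `t` along the geodesic towards `e₂`. -/
def rotX (t : ℝ) : SO3 := ⟨_, rotX_mem t⟩

/-- The frame `(∂_θ, (1 / sin θ) ∂_φ)` at the point with spherical coordinates `(θ, φ)`. -/
def frame (θ φ : ℝ) : SO3 := rotZ φ * rotY θ

/-- The nine entries of a frame. -/
def entries (R : SO3) : Fin 3 → Fin 3 → ℝ := fun i j => (R : Matrix (Fin 3) (Fin 3) ℝ) i j

/-- Complex functions of `u ∈ ℝ` and of a frame of the sphere. -/
abbrev ScriFun : Type := ℝ → SO3 → ℂ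

/-- Smoothness of a function on the (closed) submanifold of frames, via smooth extensions. -/
def SphereSmooth (η : SO3 → ℂ) : Prop :=
  ∃ g : (Fin 3 → Fin 3 → ℝ) → ℂ, ContDiff ℝ ∞ g ∧ ∀ R, η R = g (entries R)

/-- Smoothness of a function on `ℝ × SO3`, via smooth extensions. -/
def ScriSmooth (f : ScriFun) : Prop :=
  ∃ g : ℝ × (Fin 3 → Fin 3 → ℝ) → ℂ, ContDiff ℝ ∞ g ∧ ∀ u R, f u R = g (u, entries R)

/-- `η` has spin-weight `s`. -/
def HasSpin (s : ℤ) (η : SO3 → ℂ) : Prop :=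
  ∀ R ψ, η (R * rotZ ψ) = Complex.exp (s * ψ * Complex.I) * η R

/-- Derivative of `η` along the one-parameter family of frames `R * A t`, at `t = 0`. -/
def along (A : ℝ → SO3) (η : SO3 → ℂ) : SO3 → ℂ := fun R => deriv (fun t => η (R * A t)) 0

/-- The eth operator: the covariant derivative in the direction `m = (e₁ - i e₂) / √2`. -/
def eth (η : SO3 → ℂ) : SO3 → ℂ :=
  fun R => ((Real.sqrt 2 : ℝ) : ℂ)⁻¹ * (along rotY η R - Complex.I * along rotX η R)

/-- The conjugate eth operator: the covariant derivative in the direction `m̄`. -/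
def ethBar (η : SO3 → ℂ) : SO3 → ℂ :=
  fun R => ((Real.sqrt 2 : ℝ) : ℂ)⁻¹ * (along rotY η R + Complex.I * along rotX η R)

/-- Finite words in `eth` (letter `true`) and `ethBar` (letter `false`). -/
def ethWord : List Bool → (SO3 → ℂ) → (SO3 → ℂ)
  | [], η => η
  | true :: w, η => eth (ethWord w η)
  | false :: w, η => ethBar (ethWord w η)

/-- The derivative `∂_u`. -/
def du (f : ScriFun) : ScriFun := fun u R => deriv (fun v => f v R) u

/-! ### Linearity of these operators on smooth functions -/

theorem ScriSmooth.add {f g : ScriFun} (hf : ScriSmooth f) (hg : ScriSmooth g) :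
    ScriSmooth (f + g) := by
  obtain ⟨F, hF, hf⟩ := hf
  obtain ⟨G, hG, hg⟩ := hg
  exact ⟨fun p => F p + G p, hF.add hG, fun u R => by simp [hf, hg]⟩

theorem ScriSmooth.const_mul {f : ScriFun} (hf : ScriSmooth f) (c : ℂ) :
    ScriSmooth (fun u R => c * f u R) := by
  obtain ⟨F, hF, hf⟩ := hf
  exact ⟨fun p => c * F p, contDiff_const.mul hF, fun u R => by simp [hf]⟩

theorem ScriSmooth.contDiff {f : ScriFun} (hf : ScriSmooth f) (R : SO3) :
    ContDiff ℝ ∞ (fun u => f u R) := by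
  obtain ⟨F, hF, hf⟩ := hf
  simp only [hf]
  exact hF.comp (contDiff_id.prodMk contDiff_const)

theorem sphereSmooth_iff {η : SO3 → ℂ} : SphereSmooth η ↔ ScriSmooth (fun _ => η) := by
  constructor
  · rintro ⟨g, hg, h⟩
    exact ⟨fun p => g p.2, hg.comp contDiff_snd, fun u R => h R⟩
  · rintro ⟨g, hg, h⟩
    exact ⟨fun M => g (0, M), hg.comp (contDiff_const.prodMk contDiff_id), fun R => h 0 R⟩

/-- Curves of frames through the identity whose entries are differentiable there. -/
def GoodCurve (A : ℝ → SO3) : Prop :=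
  A 0 = 1 ∧ ∃ B : Fin 3 → Fin 3 → ℝ, ∀ i j, HasDerivAt (fun t => entries (A t) i j) (B i j) 0

theorem goodCurve_rotY : GoodCurve rotY := by
  refine ⟨?_, !![0, 0, 1; 0, 0, 0; -1, 0, 0], ?_⟩
  · apply Subtype.ext
    ext i j
    fin_cases i <;> fin_cases j <;> simp [rotY]
  · have hs := Real.hasDerivAt_sin 0
    have hc := Real.hasDerivAt_cos 0
    have hn := hs.neg
    simp only [Real.cos_zero, Real.sin_zero, neg_zero] at hs hc hn
    intro i j
    fin_cases i <;> fin_cases j <;> simp [rotY, entries] <;>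
      first | exact hasDerivAt_const _ _ | exact hs | exact hc | exact hn

theorem goodCurve_rotX : GoodCurve rotX := by
  refine ⟨?_, !![0, 0, 0; 0, 0, 1; 0, -1, 0], ?_⟩
  · apply Subtype.ext
    ext i j
    fin_cases i <;> fin_cases j <;> simp [rotX]
  · have hs := Real.hasDerivAt_sin 0
    have hc := Real.hasDerivAt_cos 0
    have hn := hs.neg
    simp only [Real.cos_zero, Real.sin_zero, neg_zero] at hs hc hn
    intro i j
    fin_cases i <;> fin_cases j <;> simp [rotX, entries] <;>
      first | exact hasDerivAt_const _ _ | exact hs | exact hc | exact hn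

theorem ScriSmooth.along_aux {f : ScriFun} (hf : ScriSmooth f) {A : ℝ → SO3} (hA : GoodCurve A) :
    ScriSmooth (fun u => along A (f u)) ∧
      ∀ u R, DifferentiableAt ℝ (fun t => f u (R * A t)) 0 := by
  obtain ⟨g, hg, hfg⟩ := hf
  obtain ⟨hA0, B, hB⟩ := hA
  let mulB : (Fin 3 → Fin 3 → ℝ) → (Fin 3 → Fin 3 → ℝ) := fun M i j => ∑ k, M i k * B k j
  have key : ∀ u R, HasDerivAt (fun t => f u (R * A t))
      (fderiv ℝ g (u, entries R) (0, mulB (entries R))) 0 := by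
    intro u R
    have hc : HasDerivAt (fun t => (u, entries (R * A t))) ((0 : ℝ), mulB (entries R)) 0 := by
      refine (hasDerivAt_const _ _).prodMk ?_
      rw [hasDerivAt_pi]
      intro i
      rw [hasDerivAt_pi]
      intro j
      have : (fun t => entries (R * A t) i j) =
          fun t => ∑ k, entries R i k * entries (A t) k j := by
        funext t
        simp [entries, Matrix.mul_apply]
      rw [this]
      exact HasDerivAt.fun_sum fun k _ => (hB k j).const_mul _
    have hgd : HasFDerivAt g (fderiv ℝ g (u, entries R)) (u, entries (R * A 0)) := by
      rw [hA0, mul_one]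
      exact (hg.differentiable (by simp) _).hasFDerivAt
    have := hgd.comp_hasDerivAt (0 : ℝ) hc
    simpa [Function.comp_def, hfg] using this
  refine ⟨⟨fun p => fderiv ℝ g p (0, mulB p.2), ?_, fun u R => (key u R).deriv⟩,
    fun u R => (key u R).differentiableAt⟩
  refine (hg.fderiv_right (m := ∞) (by simp)).clm_apply (contDiff_const.prodMk ?_)
  rw [contDiff_pi]
  intro i
  rw [contDiff_pi]
  intro j
  fun_prop

theorem ScriSmooth.eth {f : ScriFun} (hf : ScriSmooth f) :
    ScriSmooth (fun u => AS.eth (f u)) := by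
  have h := ((hf.along_aux goodCurve_rotY).1.add
    ((hf.along_aux goodCurve_rotX).1.const_mul (-Complex.I))).const_mul
      ((Real.sqrt 2 : ℝ) : ℂ)⁻¹
  convert h using 3 with u R
  simp [AS.eth, sub_eq_add_neg]

theorem ScriSmooth.ethBar {f : ScriFun} (hf : ScriSmooth f) :
    ScriSmooth (fun u => AS.ethBar (f u)) := by
  have h := ((hf.along_aux goodCurve_rotY).1.add
    ((hf.along_aux goodCurve_rotX).1.const_mul Complex.I)).const_mul
      ((Real.sqrt 2 : ℝ) : ℂ)⁻¹
  exact h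

theorem ScriSmooth.ethWord {f : ScriFun} (hf : ScriSmooth f) :
    ∀ w, ScriSmooth (fun u => AS.ethWord w (f u))
  | [] => hf
  | true :: w => (hf.ethWord w).eth
  | false :: w => (hf.ethWord w).ethBar

theorem along_add {η ζ : SO3 → ℂ} (hη : SphereSmooth η) (hζ : SphereSmooth ζ) {A : ℝ → SO3}
    (hA : GoodCurve A) : along A (η + ζ) = along A η + along A ζ := by
  funext R
  exact deriv_add (((sphereSmooth_iff.1 hη).along_aux hA).2 0 R)
    (((sphereSmooth_iff.1 hζ).along_aux hA).2 0 R)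

theorem along_smul (c : ℝ) (η : SO3 → ℂ) (A : ℝ → SO3) : along A (c • η) = c • along A η := by
  funext R
  simp only [along, Pi.smul_apply]
  exact deriv_fun_const_smul_field (𝕜 := ℝ) c _

theorem eth_add {η ζ : SO3 → ℂ} (hη : SphereSmooth η) (hζ : SphereSmooth ζ) :
    eth (η + ζ) = eth η + eth ζ := by
  funext R
  simp only [eth, along_add hη hζ goodCurve_rotX, along_add hη hζ goodCurve_rotY, Pi.add_apply]
  ring

theorem ethBar_add {η ζ : SO3 → ℂ} (hη : SphereSmooth η) (hζ : SphereSmooth ζ) :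
    ethBar (η + ζ) = ethBar η + ethBar ζ := by
  funext R
  simp only [ethBar, along_add hη hζ goodCurve_rotX, along_add hη hζ goodCurve_rotY,
    Pi.add_apply]
  ring

theorem eth_smul (c : ℝ) (η : SO3 → ℂ) : eth (c • η) = c • eth η := by
  funext R
  simp only [eth, along_smul, Pi.smul_apply, Complex.real_smul]
  ring

theorem ethBar_smul (c : ℝ) (η : SO3 → ℂ) : ethBar (c • η) = c • ethBar η := by
  funext R
  simp only [ethBar, along_smul, Pi.smul_apply, Complex.real_smul]
  ring

theorem SphereSmooth.ethWord {η : SO3 → ℂ} (hη : SphereSmooth η) (w : List Bool) :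
    SphereSmooth (AS.ethWord w η) :=
  sphereSmooth_iff.2 ((sphereSmooth_iff.1 hη).ethWord w)

theorem ethWord_add {η ζ : SO3 → ℂ} (hη : SphereSmooth η) (hζ : SphereSmooth ζ) :
    ∀ w, ethWord w (η + ζ) = ethWord w η + ethWord w ζ
  | [] => rfl
  | true :: w => by
      simp only [ethWord, ethWord_add hη hζ w, eth_add (hη.ethWord w) (hζ.ethWord w)]
  | false :: w => by
      simp only [ethWord, ethWord_add hη hζ w, ethBar_add (hη.ethWord w) (hζ.ethWord w)]

theorem ethWord_smul (c : ℝ) (η : SO3 → ℂ) : ∀ w, ethWord w (c • η) = c • ethWord w η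
  | [] => rfl
  | true :: w => by simp only [ethWord, ethWord_smul c η w, eth_smul]
  | false :: w => by simp only [ethWord, ethWord_smul c η w, ethBar_smul]

theorem ScriSmooth.sphere {f : ScriFun} (hf : ScriSmooth f) (u : ℝ) : SphereSmooth (f u) := by
  obtain ⟨g, hg, h⟩ := hf
  exact ⟨fun M => g (u, M), hg.comp (contDiff_const.prodMk contDiff_id), fun R => h u R⟩

theorem SphereSmooth.add {η ζ : SO3 → ℂ} (hη : SphereSmooth η) (hζ : SphereSmooth ζ) :
    SphereSmooth (η + ζ) :=
  sphereSmooth_iff.2 ((sphereSmooth_iff.1 hη).add (sphereSmooth_iff.1 hζ))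

/-! ## The space of purely electric spin-2 functions on the sphere -/

/-- Purely electric spin-2 functions: `eth² ς` with `ς` a smooth real function on the sphere. -/
def electricSpace : Submodule ℝ (SO3 → ℂ) where
  carrier := {η | ∃ ς : SO3 → ℝ, HasSpin 0 (fun R => (ς R : ℂ)) ∧
    SphereSmooth (fun R => (ς R : ℂ)) ∧ η = eth (eth fun R => (ς R : ℂ))}
  add_mem' := by
    rintro _ _ ⟨a, ha, ha', rfl⟩ ⟨b, hb, hb', rfl⟩
    have e : (fun R => ((a R + b R : ℝ) : ℂ)) = (fun R => (a R : ℂ)) + fun R => (b R : ℂ) := by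
      funext R; simp
    refine ⟨fun R => a R + b R, fun R ψ => ?_, ?_, ?_⟩
    · have h1 := ha R ψ
      have h2 := hb R ψ
      simp only [Complex.ofReal_add, h1, h2]
      ring
    · rw [e]; exact ha'.add hb'
    · rw [e, eth_add ha' hb']
      exact (eth_add (ha'.ethWord [true]) (hb'.ethWord [true])).symm
  zero_mem' := by
    have e : (fun _ : SO3 => ((0 : ℝ) : ℂ)) = (0 : ℝ) • (fun _ : SO3 => (0 : ℂ)) := by
      funext R; simp
    refine ⟨fun _ => 0, fun R ψ => by simp, ⟨fun _ => 0, contDiff_const, fun R => by simp⟩, ?_⟩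
    rw [e, eth_smul, eth_smul]
    simp
  smul_mem' := by
    rintro c _ ⟨a, ha, ⟨g, hg, hga⟩, rfl⟩
    have e : (fun R => ((c * a R : ℝ) : ℂ)) = c • fun R => (a R : ℂ) := by
      funext R; simp
    refine ⟨fun R => c * a R, fun R ψ => ?_, ⟨fun M => (c : ℂ) * g M, ?_, fun R => ?_⟩, ?_⟩
    · have h1 := ha R ψ
      simp only [Complex.ofReal_mul, h1]
      ring
    · exact contDiff_const.mul hg
    · simp [hga]
    · rw [e, eth_smul, eth_smul]

/-- The space `𝓔` of purely electric, smooth spin-2 functions on the sphere. -/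
def Electric : Type := electricSpace

instance : AddCommGroup Electric := inferInstanceAs (AddCommGroup electricSpace)
instance : Module ℝ Electric := inferInstanceAs (Module ℝ electricSpace)

/-- The underlying function. -/
def Electric.fn (a : Electric) : SO3 → ℂ := Subtype.val a

/-- The Fréchet topology of `C^∞`: uniform convergence of all `eth`, `ethBar` derivatives, i.e. the
topology of the seminorms `sup |𝓓 a|`, with `𝓓` a word. -/
instance : TopologicalSpace Electric :=
  ⨅ w : List Bool, TopologicalSpace.induced
    (fun a : Electric => UniformFun.ofFun (ethWord w a.fn)) inferInstance

/-! ## The spaces of shears and news, and the phase space -/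

/-- `(1 + u²)^s ∂_u^k 𝓓 f`, with `𝓓` the word `w`. -/
def weighted (s : ℝ) (k : ℕ) (w : List Bool) (f : ScriFun) : ℝ × SO3 → ℂ :=
  fun x => (((1 + x.1 ^ 2) ^ s : ℝ) : ℂ) * iteratedDeriv k (fun v => ethWord w (f v) x.2) x.1

theorem weighted_add {f g : ScriFun} (hf : ScriSmooth f) (hg : ScriSmooth g) (s : ℝ) (k : ℕ)
    (w : List Bool) : weighted s k w (f + g) = weighted s k w f + weighted s k w g := by
  funext x
  have e : (fun v => ethWord w ((f + g) v) x.2) =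
      (fun v => ethWord w (f v) x.2) + fun v => ethWord w (g v) x.2 := by
    funext v
    simp [ethWord_add (hf.sphere v) (hg.sphere v)]
  rw [Pi.add_apply]
  unfold weighted
  rw [e, iteratedDeriv_add
    (((hf.ethWord w).contDiff x.2).contDiffAt.of_le (by exact_mod_cast le_top))
    (((hg.ethWord w).contDiff x.2).contDiffAt.of_le (by exact_mod_cast le_top))]
  ring

theorem weighted_smul {f : ScriFun} (hf : ScriSmooth f) (c : ℝ) (s : ℝ) (k : ℕ)
    (w : List Bool) : weighted s k w (c • f) = c • weighted s k w f := by
  funext x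
  have e : (fun v => ethWord w ((c • f) v) x.2) = c • (fun v => ethWord w (f v) x.2) := by
    funext v
    simp [ethWord_smul]
  rw [Pi.smul_apply]
  unfold weighted
  rw [e, iteratedDeriv_const_smul
    (((hf.ethWord w).contDiff x.2).contDiffAt.of_le (by exact_mod_cast le_top)) c]
  simp only [Complex.real_smul]
  ring

/-- The conditions defining the Ashtekar-Streubel space of shears with parameter `ε`: smooth spin-2
functions on scri whose `u`-derivatives of order `k ≥ 1` decay like `(1 + u²)^(-k/2-ε)` together
with all their angular derivatives, with purely electric limits as `u → ±∞`. -/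
structure IsShear (ε : ℝ) (f : ScriFun) : Prop where
  smooth : ScriSmooth f
  spin : ∀ u, HasSpin 2 (f u)
  decay : ∀ k : ℕ, 1 ≤ k → ∀ w : List Bool, ∃ C : ℝ, ∀ x, ‖weighted (k / 2 + ε) k w f x‖ ≤ C
  limTop : ∃ a : Electric, ∀ R, Tendsto (fun u => f u R) atTop (𝓝 (a.fn R))
  limBot : ∃ a : Electric, ∀ R, Tendsto (fun u => f u R) atBot (𝓝 (a.fn R))

theorem isShear_zero (ε : ℝ) : IsShear ε 0 where
  smooth := ⟨fun _ => 0, contDiff_const, fun u R => rfl⟩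
  spin := fun u R ψ => by simp
  decay := fun k _ w => ⟨0, fun x => by
    have h := weighted_smul (f := 0) ⟨fun _ => 0, contDiff_const, fun u R => rfl⟩ 0
      (k / 2 + ε) k w
    rw [zero_smul, zero_smul] at h
    simp [h]⟩
  limTop := ⟨0, fun R => tendsto_const_nhds⟩
  limBot := ⟨0, fun R => tendsto_const_nhds⟩

theorem IsShear.add {ε : ℝ} {f g : ScriFun} (hf : IsShear ε f) (hg : IsShear ε g) :
    IsShear ε (f + g) where
  smooth := hf.smooth.add hg.smooth
  spin := fun u R ψ => by
    have h1 := hf.spin u R ψ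
    have h2 := hg.spin u R ψ
    simp only [Pi.add_apply, h1, h2]
    ring
  decay := fun k hk w => by
    obtain ⟨C, hC⟩ := hf.decay k hk w
    obtain ⟨D, hD⟩ := hg.decay k hk w
    refine ⟨C + D, fun x => ?_⟩
    rw [weighted_add hf.smooth hg.smooth]
    exact (norm_add_le _ _).trans (add_le_add (hC x) (hD x))
  limTop := by
    obtain ⟨a, ha⟩ := hf.limTop
    obtain ⟨b, hb⟩ := hg.limTop
    exact ⟨a + b, fun R => (ha R).add (hb R)⟩
  limBot := by
    obtain ⟨a, ha⟩ := hf.limBot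
    obtain ⟨b, hb⟩ := hg.limBot
    exact ⟨a + b, fun R => (ha R).add (hb R)⟩

theorem IsShear.smul {ε : ℝ} {f : ScriFun} (hf : IsShear ε f) (c : ℝ) : IsShear ε (c • f) where
  smooth := by
    have h := hf.smooth.const_mul (c : ℂ)
    have e : c • f = fun u R => (c : ℂ) * f u R := by
      funext u R; simp
    rw [e]; exact h
  spin := fun u R ψ => by
    have h1 := hf.spin u R ψ
    simp only [Pi.smul_apply, h1, Complex.real_smul]
    ring
  decay := fun k hk w => by
    obtain ⟨C, hC⟩ := hf.decay k hk w
    refine ⟨|c| * C, fun x => ?_⟩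
    rw [weighted_smul hf.smooth, Pi.smul_apply, norm_smul, Real.norm_eq_abs]
    exact mul_le_mul_of_nonneg_left (hC x) (abs_nonneg c)
  limTop := by
    obtain ⟨a, ha⟩ := hf.limTop
    exact ⟨c • a, fun R => (ha R).const_smul c⟩
  limBot := by
    obtain ⟨a, ha⟩ := hf.limBot
    exact ⟨c • a, fun R => (ha R).const_smul c⟩

/-- The space of shears, as a real vector space of functions. -/
def shearSpace (ε : ℝ) : Submodule ℝ ScriFun where
  carrier := {f | IsShear ε f}
  add_mem' := IsShear.add
  zero_mem' := isShear_zero ε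
  smul_mem' := fun c _ hf => hf.smul c

/-- The space of conjugated news `N̄`: all `∂_u f` with `f` in the space of shears. -/
def newsSpace (ε : ℝ) : Submodule ℝ ScriFun where
  carrier := {g | ∃ f ∈ shearSpace ε, g = du f}
  add_mem' := by
    rintro _ _ ⟨f, hf, rfl⟩ ⟨g, hg, rfl⟩
    refine ⟨f + g, add_mem hf hg, ?_⟩
    funext u R
    exact (deriv_add ((hf.smooth.contDiff R).differentiable (by simp) u)
      ((hg.smooth.contDiff R).differentiable (by simp) u)).symm
  zero_mem' := ⟨0, zero_mem _, by funext u R; simp [du]⟩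
  smul_mem' := by
    rintro c _ ⟨f, hf, rfl⟩
    refine ⟨c • f, Submodule.smul_mem _ c hf, ?_⟩
    funext u R
    exact (deriv_fun_const_smul_field (𝕜 := ℝ) c (fun v => f v R)).symm

/-- The space `𝓕₀` of shears `σ`. -/
def Shear (ε : ℝ) : Type := shearSpace ε

/-- The space `𝓕₁` of conjugated news `N̄`. -/
def News (ε : ℝ) : Type := newsSpace ε

instance (ε : ℝ) : AddCommGroup (Shear ε) := inferInstanceAs (AddCommGroup (shearSpace ε))
instance (ε : ℝ) : Module ℝ (Shear ε) := inferInstanceAs (Module ℝ (shearSpace ε))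
instance (ε : ℝ) : AddCommGroup (News ε) := inferInstanceAs (AddCommGroup (newsSpace ε))
instance (ε : ℝ) : Module ℝ (News ε) := inferInstanceAs (Module ℝ (newsSpace ε))

variable {ε : ℝ}

/-- The underlying function. -/
def Shear.fn (f : Shear ε) : ScriFun := Subtype.val f

/-- The underlying function. -/
def News.fn (g : News ε) : ScriFun := Subtype.val g

theorem Shear.isShear (f : Shear ε) : IsShear ε f.fn := Subtype.property f

/-- The limit `σ₊` of a shear as `u → +∞`. -/
def Shear.plus (f : Shear ε) : Electric := f.isShear.limTop.choose

/-- The limit `σ₋` of a shear as `u → -∞`. -/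
def Shear.minus (f : Shear ε) : Electric := f.isShear.limBot.choose

/-- The Fréchet topology of the seminorms `sup |𝓓 f₋|` and `sup |(1+u²)^(k/2+ε) ∂_u^k 𝓓 f|`,
`k ≥ 1`, with `𝓓` a word. -/
instance : TopologicalSpace (Shear ε) :=
  TopologicalSpace.induced (fun f : Shear ε => f.minus) inferInstance ⊓
  ⨅ (k : ℕ) (_ : 1 ≤ k) (w : List Bool), TopologicalSpace.induced
    (fun f : Shear ε => UniformFun.ofFun (weighted (k / 2 + ε) k w f.fn)) inferInstance

/-- The Fréchet topology of the seminorms `sup |(1+u²)^(k/2+1/2+ε) ∂_u^k 𝓓 g|`, `k ≥ 0`. -/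
instance : TopologicalSpace (News ε) :=
  ⨅ (k : ℕ) (w : List Bool), TopologicalSpace.induced
    (fun g : News ε => UniformFun.ofFun (weighted (k / 2 + 1 / 2 + ε) k w g.fn)) inferInstance

variable (ε) in
/-- The kinematical phase space `𝓟 = 𝓕₀ × 𝓕₁`, whose points are pairs `(σ, N̄)`.  It is a vector
space, so its tangent vectors are pairs `(Xσ, XN̄)` in the same space. -/
abbrev Phase : Type := Shear ε × News ε

variable (ε) in
/-- The constrained phase space `𝓟_K`: the points with `N̄ + ∂_u σ = 0`. -/
def onShell : Set (Phase ε) := {p | p.2.fn + du p.1.fn = 0}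

/-! ## Symplectic form, constraints, proper observables -/

/-- The volume element `du ∧ sin θ dθ ∧ dφ` of scri in the coordinates `(u, θ, φ)`. -/
def scriMeasure : Measure (ℝ × ℝ × ℝ) :=
  (volume : Measure ℝ).prod
    (((volume : Measure (ℝ × ℝ)).restrict
      (Set.Ioo 0 Real.pi ×ˢ Set.Ioo 0 (2 * Real.pi))).withDensity
        fun y => ENNReal.ofReal (Real.sin y.1))

/-- A function of `u` and of the frame, evaluated at the coordinate frame at `(u, θ, φ)`. -/
def atPoint (f : ScriFun) (x : ℝ × ℝ × ℝ) : ℂ := f x.1 (frame x.2.1 x.2.2)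

/-- The symplectic form `Ω(X, Y) = (1/4π) Re ∫ (XN · Yσ - YN · Xσ)`. -/
def Omega (X Y : Phase ε) : ℝ :=
  1 / (4 * Real.pi) * (∫ x, ((starRingEnd ℂ) (atPoint X.2.fn x) * atPoint Y.1.fn x -
    (starRingEnd ℂ) (atPoint Y.2.fn x) * atPoint X.1.fn x) ∂scriMeasure).re

/-- `X` is a smooth Hamiltonian vector field of `F`: `δF = - I_X Ω`. -/
def IsHamiltonianField (F : Phase ε → ℝ) (X : Phase ε → Phase ε) : Prop :=
  IsSmooth X ∧ ∀ p Y, HasDirDeriv F p Y (-Omega (X p) Y)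

/-- Regular functions: those with a smooth Hamiltonian vector field. -/
def IsRegular (F : Phase ε → ℝ) : Prop := ∃ X, IsHamiltonianField F X

open Classical in
/-- The Hamiltonian vector field of a regular function. -/
def hamField (F : Phase ε → ℝ) : Phase ε → Phase ε :=
  if h : IsRegular F then h.choose else 0

/-- The Poisson bracket `{F, G} = - Ω(X_F, X_G)` of regular functions. -/
def poisson (F G : Phase ε → ℝ) (p : Phase ε) : ℝ := -Omega (hamField F p) (hamField G p)

/-- The integrand of the smeared constraint. -/
def constraintIntegrand (φ : ScriFun) (p : Phase ε) (x : ℝ × ℝ × ℝ) : ℂ :=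
  (starRingEnd ℂ) (atPoint φ x) * atPoint (p.2.fn + du p.1.fn) x

/-- The smeared constraint `K_φ = (1/4π) Re ∫ φ̄ (N̄ + ∂_u σ)`. -/
def smearedK (φ : ScriFun) (p : Phase ε) : ℝ :=
  1 / (4 * Real.pi) * (∫ x, constraintIntegrand φ p x ∂scriMeasure).re

variable (ε) in
/-- The smearings `φ` for which `K_φ` is well defined and regular on `𝓟`. -/
def regularSmearings : Set ScriFun :=
  {φ | ScriSmooth φ ∧ (∀ u, HasSpin 2 (φ u)) ∧
    (∀ p : Phase ε, Integrable (constraintIntegrand φ p) scriMeasure) ∧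
    IsRegular (smearedK φ : Phase ε → ℝ)}

/-- A regular function `F` is tangentially extensible if for some (field-dependent) `φ` with values
in the regular smearings, `{K_φ, K_φ'} = - {F, K_φ'}` on the constraint surface for every regular
smearing `φ'`; the tangential extension is then `F + K_φ`. -/
def IsTangentiallyExtensible (F : Phase ε → ℝ) : Prop :=
  IsRegular F ∧ ∃ φ : Phase ε → ScriFun, (∀ p, φ p ∈ regularSmearings ε) ∧
    ∀ p ∈ onShell ε, ∀ φ' ∈ regularSmearings ε,
      poisson (smearedK (φ p)) (smearedK φ') p = -poisson F (smearedK φ') p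

/-- Proper observables: smooth real functions on phase space that are tangentially extensible. -/
def IsProperObservable (F : Phase ε → ℝ) : Prop :=
  IsSmooth F ∧ IsTangentiallyExtensible F

/-- `F` directly measures the functional `Θ` of the asymptotic shears: on the constraint surface,
`F = Θ(σ₊, σ₋)`. -/
def DirectlyMeasures (F : Phase ε → ℝ) (Θ : Electric × Electric → ℝ) : Prop :=
  ∀ p ∈ onShell ε, F p = Θ (p.1.plus, p.1.minus)

end AS

end

noncomputable section

namespace AS

/-! ## Spin-weights of the eth operator -/

/-! The heart of the matter is that `F` is invariant, on shell, under `σ ↦ σ + a` with `a` electric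
and independent of `u`. Let `X` be the Hamiltonian vector of `F` at an on-shell point, `H` that of
the extending constraint `K_φ`, and write `⟨f, g⟩` for `Re ∫ f̄ g`. The derivative of `F` along `(a,
0)` is `-⟨a, X_N̄⟩ / 4π`, so it suffices that `⟨a, X_N̄⟩ = 0`.

Three facts give this. (1) If `χ` has bounded support in `u`, the on-shell direction `(χ a, -χ' a)`
leaves both asymptotic shears unchanged, hence also `F`. Integration by parts turns this into `⟨χ a,
X_N̄⟩ = ⟨χ a, ∂_u X_σ⟩`; exhausting the line by plateau functions replaces `χ` by `1`. Since `K_φ`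
does not vary in on-shell directions, the same holds for `H`. (2) The translation `(a, 0)` is itself
such a direction, so `⟨a, H_N̄⟩ = 0`, and by (1) also `⟨a, ∂_u H_σ⟩ = 0`. (3) Tangential
extensibility, tested with `φ' = χ a`, says that the constraint functions of `X` and `H` have
opposite pairings with `χ a`. In the limit `⟨a, X_N̄ + ∂_u X_σ⟩ = 0`, which by (1) is `2⟨a, X_N̄⟩ =
0`.

Every pair of electric functions is the pair of limits of an on-shell shear, so `Θ(a + c, b + c) =
Θ(a, b)`. The choice `c = -b` in effect gives (i); shifting both limits from `0` to `s / 2` gives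
(ii). The carrying lemmas are `pair_cut_du`, `tendsto_pair_plateau`, `pair_news_eq_pair_du`,
`hasDirDeriv_translation` and `DirectlyMeasures.translation_invariant`. -/

theorem hasDerivAt_along {η : SO3 → ℂ} {g : (Fin 3 → Fin 3 → ℝ) → ℂ} (hg : ContDiff ℝ ∞ g)
    (hη : ∀ R, η R = g (entries R)) {A : ℝ → SO3} (hA : A 0 = 1) {B : Fin 3 → Fin 3 → ℝ}
    (hB : ∀ i j, HasDerivAt (fun t => entries (A t) i j) (B i j) 0) (R : SO3) :
    HasDerivAt (fun t => η (R * A t))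
      (fderiv ℝ g (entries R) (fun i j => ∑ k, entries R i k * B k j)) 0 := by
  have hc : HasDerivAt (fun t => entries (R * A t))
      (fun i j => ∑ k, entries R i k * B k j) 0 := by
    rw [hasDerivAt_pi]
    intro i
    rw [hasDerivAt_pi]
    intro j
    have : (fun t => entries (R * A t) i j) =
        fun t => ∑ k, entries R i k * entries (A t) k j := by
      funext t
      simp [entries, Matrix.mul_apply]
    rw [this]
    exact HasDerivAt.fun_sum fun k _ => (hB k j).const_mul _
  have hgd : HasFDerivAt g (fderiv ℝ g (entries R)) (entries (R * A 0)) := by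
    rw [hA, mul_one]
    exact (hg.differentiable (by simp) _).hasFDerivAt
  have := hgd.comp_hasDerivAt (0 : ℝ) hc
  simpa [Function.comp_def, hη] using this

theorem rotZ_neg_mul (ψ : ℝ) : rotZ (-ψ) * rotZ ψ = 1 := by
  have h := Real.sin_sq_add_cos_sq ψ
  apply Subtype.ext
  ext i j
  fin_cases i <;> fin_cases j <;>
    simp [rotZ] <;> nlinarith

theorem rotZ_mul_neg (ψ : ℝ) : rotZ ψ * rotZ (-ψ) = 1 := by
  simpa using rotZ_neg_mul (-ψ)

theorem hasDerivAt_entries_rotY (i j : Fin 3) : HasDerivAt (fun t => entries (rotY t) i j)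
    ((!![0, 0, 1; 0, 0, 0; -1, 0, 0] : Matrix (Fin 3) (Fin 3) ℝ) i j) 0 := by
  have hs := Real.hasDerivAt_sin 0
  have hc := Real.hasDerivAt_cos 0
  have hn := hs.neg
  simp only [Real.cos_zero, Real.sin_zero, neg_zero] at hs hc hn
  fin_cases i <;> fin_cases j <;> simp [rotY, entries] <;>
    first | exact hasDerivAt_const _ _ | exact hs | exact hc | exact hn

theorem hasDerivAt_entries_rotX (i j : Fin 3) : HasDerivAt (fun t => entries (rotX t) i j)
    ((!![0, 0, 0; 0, 0, 1; 0, -1, 0] : Matrix (Fin 3) (Fin 3) ℝ) i j) 0 := by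
  have hs := Real.hasDerivAt_sin 0
  have hc := Real.hasDerivAt_cos 0
  have hn := hs.neg
  simp only [Real.cos_zero, Real.sin_zero, neg_zero] at hs hc hn
  fin_cases i <;> fin_cases j <;> simp [rotX, entries] <;>
    first | exact hasDerivAt_const _ _ | exact hs | exact hc | exact hn

/-- The derivative along a curve of frames, at a frame rotated by `rotZ ψ`. -/
theorem along_mul_rotZ {s : ℤ} {η : SO3 → ℂ} {g : (Fin 3 → Fin 3 → ℝ) → ℂ}
    (hs : HasSpin s η) (hg : ContDiff ℝ ∞ g) (hη : ∀ R, η R = g (entries R)) {A : ℝ → SO3}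
    (hA : A 0 = 1) {B : Matrix (Fin 3) (Fin 3) ℝ}
    (hB : ∀ i j, HasDerivAt (fun t => entries (A t) i j) (B i j) 0) (R : SO3) (ψ : ℝ) :
    along A η (R * rotZ ψ) = Complex.exp (s * ψ * Complex.I) *
      fderiv ℝ g (entries R) (fun i j => ∑ k, entries R i k *
        ((rotZ ψ : Matrix (Fin 3) (Fin 3) ℝ) * B * (rotZ (-ψ) : Matrix (Fin 3) (Fin 3) ℝ)) k j) := by
  have h := hasDerivAt_along hg hη (A := fun t => rotZ ψ * A t * rotZ (-ψ))
    (by rw [hA, mul_one, rotZ_mul_neg]) (B := fun k j =>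
      ((rotZ ψ : Matrix (Fin 3) (Fin 3) ℝ) * B * (rotZ (-ψ) : Matrix (Fin 3) (Fin 3) ℝ)) k j) ?_ R
  -- With `Z = rotZ ψ`, write `R Z A = R (Z A Z⁻¹) Z`. The spin-weight extracts the phase of the
  -- last factor and leaves the conjugated curve, whose generator is `Z B Z⁻¹`.
  · have e : (fun t => η (R * rotZ ψ * A t)) = fun t => Complex.exp (s * ψ * Complex.I) *
        η (R * (rotZ ψ * A t * rotZ (-ψ))) := by
      funext t
      rw [← hs]
      simp only [mul_assoc, rotZ_neg_mul, mul_one]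
    unfold along
    rw [e]
    exact (h.const_mul _).deriv
  · intro i j
    have e : (fun t => entries (rotZ ψ * A t * rotZ (-ψ)) i j) = fun t =>
        ∑ l, (∑ k, entries (rotZ ψ) i k * entries (A t) k l) * entries (rotZ (-ψ)) l j := by
      funext t
      simp [entries, Matrix.mul_apply]
    simp only [e, Matrix.mul_apply]
    exact HasDerivAt.fun_sum fun l _ =>
      (HasDerivAt.fun_sum fun k _ => (hB k l).const_mul _).mul_const _

theorem along_rotY_mul_rotZ {s : ℤ} {η : SO3 → ℂ} (hs : HasSpin s η) (hη : SphereSmooth η)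
    (R : SO3) (ψ : ℝ) : along rotY η (R * rotZ ψ) = Complex.exp (s * ψ * Complex.I) *
      (Real.cos ψ * along rotY η R + Real.sin ψ * along rotX η R) := by
  obtain ⟨g, hg, h⟩ := hη
  have hY := hasDerivAt_along hg h goodCurve_rotY.1 hasDerivAt_entries_rotY R
  have hX := hasDerivAt_along hg h goodCurve_rotX.1 hasDerivAt_entries_rotX R
  rw [along_mul_rotZ hs hg h goodCurve_rotY.1 hasDerivAt_entries_rotY, along, along, hY.deriv,
    hX.deriv, ← Complex.real_smul, ← Complex.real_smul, ← map_smul, ← map_smul, ← map_add]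
  -- What remains is the rotation of the generators under conjugation: `Z B_Y Z⁻¹ = cos ψ B_Y + sin
  -- ψ B_X`.
  congr 2
  funext i j
  fin_cases j <;> simp [rotZ, Matrix.mul_apply, Fin.sum_univ_three] <;> ring_nf

theorem along_rotX_mul_rotZ {s : ℤ} {η : SO3 → ℂ} (hs : HasSpin s η) (hη : SphereSmooth η)
    (R : SO3) (ψ : ℝ) : along rotX η (R * rotZ ψ) = Complex.exp (s * ψ * Complex.I) *
      (Real.cos ψ * along rotX η R - Real.sin ψ * along rotY η R) := by
  obtain ⟨g, hg, h⟩ := hη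
  have hY := hasDerivAt_along hg h goodCurve_rotY.1 hasDerivAt_entries_rotY R
  have hX := hasDerivAt_along hg h goodCurve_rotX.1 hasDerivAt_entries_rotX R
  rw [along_mul_rotZ hs hg h goodCurve_rotX.1 hasDerivAt_entries_rotX, along, along, hY.deriv,
    hX.deriv, ← Complex.real_smul, ← Complex.real_smul, ← map_smul, ← map_smul, ← map_sub]
  congr 2
  funext i j
  fin_cases j <;> simp [rotZ, Matrix.mul_apply, Fin.sum_univ_three] <;> ring_nf

/-- The derivatives along `rotY` and `rotX` rotate into each other as a real 2-vector, so their
combination with `-i` is an eigenvector with the extra phase `exp(iψ)`. -/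
theorem HasSpin.eth {s : ℤ} {η : SO3 → ℂ} (hs : HasSpin s η) (hη : SphereSmooth η) :
    HasSpin (s + 1) (AS.eth η) := by
  intro R ψ
  have e : Complex.exp (((s + 1 : ℤ) : ℂ) * ψ * Complex.I) =
      Complex.exp (s * ψ * Complex.I) * (Real.cos ψ + Real.sin ψ * Complex.I) := by
    rw [Complex.ofReal_cos, Complex.ofReal_sin, ← Complex.exp_mul_I, ← Complex.exp_add]
    congr 1
    push_cast
    ring
  simp only [AS.eth, along_rotX_mul_rotZ hs hη, along_rotY_mul_rotZ hs hη, e]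
  linear_combination (Complex.exp (s * ψ * Complex.I) * ((Real.sqrt 2 : ℝ) : ℂ)⁻¹ *
    Real.sin ψ * along rotX η R) * Complex.I_sq

theorem Electric.sphereSmooth (a : Electric) : SphereSmooth a.fn := by
  obtain ⟨ς, -, h, e⟩ := a.2
  have := h.ethWord [true, true]
  change SphereSmooth a.1
  rwa [e]

theorem Electric.hasSpin (a : Electric) : HasSpin 2 a.fn := by
  obtain ⟨ς, h0, h, e⟩ := a.2
  have := (h0.eth h).eth (h.ethWord [true])
  change HasSpin 2 a.1
  rwa [e]

/-! ## Bounds and integrability on scri -/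

theorem ScriSmooth.exists_bound {f : ScriFun} (hf : ScriSmooth f) (M : ℝ) :
    ∃ C, ∀ u ∈ Set.Icc (-M) M, ∀ R, ‖f u R‖ ≤ C := by
  obtain ⟨g, hg, h⟩ := hf
  -- Entries of orthogonal matrices lie in `[-1, 1]`, so the smooth extension need only be bounded
  -- on a compact box.
  have hK : IsCompact (Set.Icc (-M) M ×ˢ
      (Set.Icc (fun _ _ => -1) (fun _ _ => 1) : Set (Fin 3 → Fin 3 → ℝ))) :=
    isCompact_Icc.prod isCompact_Icc
  obtain ⟨C, hC⟩ := hK.exists_bound_of_continuousOn hg.continuous.continuousOn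
  refine ⟨C, fun u hu R => h u R ▸ hC _ ⟨hu, ?_, ?_⟩⟩ <;> intro i j
  · exact (abs_le.1 (entry_norm_bound_of_unitary R.2.1 i j)).1
  · exact (abs_le.1 (entry_norm_bound_of_unitary R.2.1 i j)).2

theorem SphereSmooth.exists_bound {η : SO3 → ℂ} (hη : SphereSmooth η) : ∃ C, ∀ R, ‖η R‖ ≤ C := by
  obtain ⟨C, hC⟩ := (sphereSmooth_iff.1 hη).exists_bound 0
  exact ⟨C, hC 0 (by simp)⟩

theorem continuous_entries_frame : Continuous fun y : ℝ × ℝ => entries (frame y.1 y.2) := by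
  refine continuous_pi fun i => continuous_pi fun j => ?_
  fin_cases i <;> fin_cases j <;>
    simp [frame, entries, rotZ, rotY] <;> fun_prop

theorem ScriSmooth.continuous_atPoint {f : ScriFun} (hf : ScriSmooth f) :
    Continuous (atPoint f) := by
  obtain ⟨g, hg, h⟩ := hf
  have e : atPoint f = fun x => g (x.1, entries (frame x.2.1 x.2.2)) := funext fun x => h _ _
  rw [e]
  exact hg.continuous.comp (continuous_fst.prodMk (continuous_entries_frame.comp continuous_snd))

theorem ScriSmooth.mul {f g : ScriFun} (hf : ScriSmooth f) (hg : ScriSmooth g) :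
    ScriSmooth (fun u R => f u R * g u R) := by
  obtain ⟨F, hF, hf⟩ := hf
  obtain ⟨G, hG, hg⟩ := hg
  exact ⟨fun p => F p * G p, hF.mul hG, fun u R => by simp [hf, hg]⟩

theorem ScriSmooth.conj {f : ScriFun} (hf : ScriSmooth f) :
    ScriSmooth (fun u R => (starRingEnd ℂ) (f u R)) := by
  obtain ⟨F, hF, hf⟩ := hf
  exact ⟨fun p => (starRingEnd ℂ) (F p), Complex.conjCLE.contDiff.comp hF,
    fun u R => by simp [hf]⟩

theorem ScriSmooth.du {f : ScriFun} (hf : ScriSmooth f) : ScriSmooth (AS.du f) := by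
  obtain ⟨g, hg, h⟩ := hf
  refine ⟨fun p => fderiv ℝ g p (1, 0),
    (hg.fderiv_right (m := ∞) (by simp)).clm_apply contDiff_const, fun u R => ?_⟩
  have hc : HasDerivAt (fun v : ℝ => (v, entries R)) ((1 : ℝ), 0) u :=
    (hasDerivAt_id u).prodMk (hasDerivAt_const _ _)
  have := ((hg.differentiable (by simp) _).hasFDerivAt).comp_hasDerivAt u hc
  unfold AS.du
  simp only [h]
  exact this.deriv

/-- The area measure of the sphere in the coordinates `(θ, φ)`. -/
def sphereMeasure : Measure (ℝ × ℝ) :=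
  ((volume : Measure (ℝ × ℝ)).restrict
    (Set.Ioo 0 Real.pi ×ˢ Set.Ioo 0 (2 * Real.pi))).withDensity fun y => ENNReal.ofReal (Real.sin y.1)

theorem scriMeasure_eq : scriMeasure = (volume : Measure ℝ).prod sphereMeasure := rfl

instance : IsFiniteMeasure sphereMeasure := by
  refine isFiniteMeasure_withDensity (ne_of_lt ?_)
  have h1 : volume (Set.Ioo 0 Real.pi ×ˢ Set.Ioo 0 (2 * Real.pi) : Set (ℝ × ℝ)) < ⊤ := by
    rw [Measure.volume_eq_prod, Measure.prod_prod, Real.volume_Ioo, Real.volume_Ioo]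
    exact ENNReal.mul_lt_top ENNReal.ofReal_lt_top ENNReal.ofReal_lt_top
  refine lt_of_le_of_lt (lintegral_mono (g := fun _ => 1) fun y => ?_) ?_
  · exact ENNReal.ofReal_le_one.2 (Real.sin_le_one _)
  · simpa using h1

theorem ScriSmooth.integrable_of_bound {f : ScriFun} (hf : ScriSmooth f) {b : ℝ → ℝ}
    (hb : Integrable b) (h : ∀ u R, ‖f u R‖ ≤ b u) : Integrable (atPoint f) scriMeasure :=
  (hb.comp_fst sphereMeasure).mono' hf.continuous_atPoint.aestronglyMeasurable
    (Eventually.of_forall fun _ => h _ _)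

theorem ScriSmooth.integrable_of_support {f : ScriFun} (hf : ScriSmooth f) {M : ℝ}
    (h : ∀ u ∉ Set.Icc (-M) M, ∀ R, f u R = 0) : Integrable (atPoint f) scriMeasure := by
  obtain ⟨C, hC⟩ := hf.exists_bound M
  refine hf.integrable_of_bound (b := (Set.Icc (-M) M).indicator fun _ => C)
    ((integrableOn_const (by simp)).integrable_indicator measurableSet_Icc) fun u R => ?_
  by_cases hu : u ∈ Set.Icc (-M) M
  · rw [Set.indicator_of_mem hu]; exact hC u hu R
  · rw [Set.indicator_of_notMem hu, h u hu R, norm_zero]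

/-- The total `u`-derivative of a function of bounded support in `u` integrates to zero. -/
theorem ScriSmooth.integral_du_eq_zero {f : ScriFun} (hf : ScriSmooth f) {M : ℝ}
    (h : ∀ u ∉ Set.Icc (-M) M, ∀ R, f u R = 0) :
    Integrable (atPoint (AS.du f)) scriMeasure ∧ ∫ x, atPoint (AS.du f) x ∂scriMeasure = 0 := by
  have hcs : ∀ R, HasCompactSupport fun u => f u R := fun R =>
    HasCompactSupport.intro isCompact_Icc fun u hu => h u hu R
  have hi : Integrable (atPoint (AS.du f)) scriMeasure :=
    hf.du.integrable_of_support (M := M) fun u hu R => by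
      have : (fun v => f v R) =ᶠ[𝓝 u] fun _ => 0 := by
        filter_upwards [isClosed_Icc.isOpen_compl.mem_nhds hu] with v hv using h v hv R
      simpa [AS.du] using this.deriv_eq
  refine ⟨hi, ?_⟩
  rw [scriMeasure_eq] at hi ⊢
  rw [integral_prod_symm _ hi]
  -- Fubini puts the `u`-integral inside, where it vanishes for each fixed frame.
  have key : ∀ R, ∫ u, deriv (fun v => f v R) u = 0 := fun R =>
    integral_eq_zero_of_hasDerivAt_of_integrable (f := fun u => f u R)
      (fun u => (((hf.contDiff R).differentiable (by simp)) u).hasDerivAt)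
      (((hf.contDiff R).continuous_deriv (by simp)).integrable_of_hasCompactSupport (hcs R).deriv)
      ((hf.contDiff R).continuous.integrable_of_hasCompactSupport (hcs R))
  exact integral_eq_zero_of_ae (Eventually.of_forall fun y => key (frame y.1 y.2))

theorem integrable_weight {ε : ℝ} (hε : 0 < ε) :
    Integrable fun u : ℝ => ((1 + u ^ 2) ^ (1 / 2 + ε))⁻¹ := by
  have h := integrable_rpow_neg_one_add_norm_sq (E := ℝ) (μ := volume) (r := 1 + 2 * ε)
    (by simp [hε])
  refine h.congr (Eventually.of_forall fun u => ?_)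
  simp only [Real.norm_eq_abs, sq_abs]
  rw [← Real.rpow_neg (by positivity)]
  congr 1
  ring

/-- The decay condition with `k = 1` and the empty word bounds `∂_u f` by a multiple of `(1 +
u²)^(-1/2-ε)`, integrable exactly because `ε > 0`. -/
theorem IsShear.exists_integrable_bound {ε : ℝ} (hε : 0 < ε) {f : ScriFun} (hf : IsShear ε f) :
    ∃ b : ℝ → ℝ, Integrable b ∧ ∀ u R, ‖AS.du f u R‖ ≤ b u := by
  obtain ⟨C, hC⟩ := hf.decay 1 le_rfl []
  refine ⟨fun u => C * ((1 + u ^ 2) ^ (1 / 2 + ε))⁻¹, (integrable_weight hε).const_mul C,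
    fun u R => ?_⟩
  have h := hC (u, R)
  have hp : 0 < (1 + u ^ 2) ^ (1 / 2 + ε) := by positivity
  simp only [weighted, ethWord, iteratedDeriv_one, Nat.cast_one, norm_mul, Complex.norm_real,
    Real.norm_eq_abs, abs_of_pos hp] at h
  change _ ≤ C * (_)⁻¹
  rw [← div_eq_mul_inv, le_div_iff₀ hp, mul_comm]
  exact h

/-! ## Shears of the form `χ(u) a` -/

/-- Smooth functions of `u` equal to `l` near `-∞` and to `r` near `+∞`. -/
structure IsCutoff (χ : ℝ → ℝ) (l r : ℝ) : Prop where
  contDiff : ContDiff ℝ ∞ χ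
  eq_off : ∃ M, (∀ u < -M, χ u = l) ∧ ∀ u > M, χ u = r

theorem isCutoff_const (c : ℝ) : IsCutoff (fun _ => c) c c :=
  ⟨contDiff_const, 0, fun _ _ => rfl, fun _ _ => rfl⟩

theorem isCutoff_smoothTransition : IsCutoff Real.smoothTransition 0 1 := by
  refine ⟨Real.smoothTransition.contDiff, 1, fun u hu => ?_, fun u hu => ?_⟩
  · exact Real.smoothTransition.zero_of_nonpos (by linarith)
  · exact Real.smoothTransition.one_of_one_le hu.le

/-- A plateau function: `1` on `[-n, n]` and `0` off `[-n-1, n+1]`. -/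
def plateau (n : ℕ) (u : ℝ) : ℝ :=
  Real.smoothTransition (n + 1 - u) * Real.smoothTransition (n + 1 + u)

theorem isCutoff_plateau (n : ℕ) : IsCutoff (plateau n) 0 0 := by
  refine ⟨?_, n + 1, fun u hu => ?_, fun u hu => ?_⟩
  · exact (Real.smoothTransition.contDiff.comp (contDiff_const.sub contDiff_id)).mul
      (Real.smoothTransition.contDiff.comp (contDiff_const.add contDiff_id))
  · rw [plateau, Real.smoothTransition.zero_of_nonpos (x := n + 1 + u) (by linarith), mul_zero]
  · rw [plateau, Real.smoothTransition.zero_of_nonpos (x := n + 1 - u) (by linarith), zero_mul]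

theorem plateau_eq_one {n : ℕ} {u : ℝ} (h : |u| ≤ n) : plateau n u = 1 := by
  have := abs_le.1 h
  rw [plateau, Real.smoothTransition.one_of_one_le (by linarith),
    Real.smoothTransition.one_of_one_le (by linarith), one_mul]

theorem abs_plateau_le (n : ℕ) (u : ℝ) : |plateau n u| ≤ 1 := by
  rw [plateau, abs_of_nonneg (mul_nonneg (Real.smoothTransition.nonneg _)
    (Real.smoothTransition.nonneg _))]
  exact mul_le_one₀ (Real.smoothTransition.le_one _) (Real.smoothTransition.nonneg _)
    (Real.smoothTransition.le_one _)

/-- The function `χ(u) a`. -/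
def cut (χ : ℝ → ℝ) (a : Electric) : ScriFun := fun u => χ u • a.fn

theorem scriSmooth_cut {χ : ℝ → ℝ} (hχ : ContDiff ℝ ∞ χ) (a : Electric) :
    ScriSmooth (cut χ a) := by
  obtain ⟨g, hg, h⟩ := a.sphereSmooth
  exact ⟨fun p => χ p.1 • g p.2, (hχ.comp contDiff_fst).smul (hg.comp contDiff_snd),
    fun u R => by simp [cut, h]⟩

theorem hasSpin_cut (χ : ℝ → ℝ) (a : Electric) (u : ℝ) : HasSpin 2 (cut χ a u) := fun R ψ => by
  simp only [cut, Pi.smul_apply, a.hasSpin R ψ, Complex.real_smul]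
  ring

theorem du_cut {χ : ℝ → ℝ} (hχ : ContDiff ℝ ∞ χ) (a : Electric) :
    du (cut χ a) = cut (deriv χ) a := by
  funext u R
  exact (((hχ.differentiable (by simp)) u).hasDerivAt.smul_const (a.fn R)).deriv

theorem IsCutoff.deriv_eq_zero {χ : ℝ → ℝ} {l r : ℝ} (hχ : IsCutoff χ l r) :
    ∃ M, ∀ u ∉ Set.Icc (-M) M, deriv χ u = 0 := by
  obtain ⟨-, M, hl, hr⟩ := hχ
  refine ⟨M, fun u hu => ?_⟩
  rw [Set.mem_Icc, not_and_or, not_le, not_le] at hu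
  rcases hu with hu | hu
  · have : χ =ᶠ[𝓝 u] fun _ => l := by
      filter_upwards [isOpen_Iio.mem_nhds hu] with v hv using hl v hv
    simpa using this.deriv_eq
  · have : χ =ᶠ[𝓝 u] fun _ => r := by
      filter_upwards [isOpen_Ioi.mem_nhds hu] with v hv using hr v hv
    simpa using this.deriv_eq

theorem hasCompactSupport_iteratedDeriv {f : ℝ → ℂ} (hf : HasCompactSupport f) :
    ∀ k, HasCompactSupport (iteratedDeriv k f)
  | 0 => by simpa using hf
  | k + 1 => by
    rw [iteratedDeriv_succ]
    exact (hasCompactSupport_iteratedDeriv hf k).deriv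

theorem isShear_cut (ε : ℝ) {χ : ℝ → ℝ} {l r : ℝ} (hχ : IsCutoff χ l r) (a : Electric) :
    IsShear ε (cut χ a) where
  smooth := scriSmooth_cut hχ.contDiff a
  spin := hasSpin_cut χ a
  decay := by
    intro k hk w
    -- At least one `u`-derivative falls on the cutoff and makes it compactly supported, so any
    -- power weight is harmless.
    obtain ⟨k, rfl⟩ : ∃ j, k = j + 1 := ⟨k - 1, by omega⟩
    obtain ⟨M, hM⟩ := hχ.deriv_eq_zero
    obtain ⟨D, hD⟩ := (a.sphereSmooth.ethWord w).exists_bound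
    set c : ℝ → ℂ := fun u => (χ u : ℂ)
    have hc : ContDiff ℝ ∞ c := Complex.ofRealCLM.contDiff.comp hχ.contDiff
    have hd : ∀ u, deriv c u = (deriv χ u : ℝ) := fun u =>
      (((hχ.contDiff.differentiable (by simp)) u).hasDerivAt.ofReal_comp).deriv
    have hcs : HasCompactSupport (iteratedDeriv (k + 1) c) := by
      rw [iteratedDeriv_succ']
      refine hasCompactSupport_iteratedDeriv (HasCompactSupport.intro isCompact_Icc
        (K := Set.Icc (-M) M) fun u hu => ?_) k
      rw [hd, hM u hu, Complex.ofReal_zero]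
    have hcont : Continuous fun u : ℝ => (((1 + u ^ 2) ^ (((k + 1 : ℕ) : ℝ) / 2 + ε) : ℝ) : ℂ) *
        iteratedDeriv (k + 1) c u := by
      refine Continuous.mul (Complex.continuous_ofReal.comp ?_)
        (hc.continuous_iteratedDeriv _ (by exact_mod_cast le_top))
      exact Continuous.rpow_const (by fun_prop) fun u => Or.inl (by positivity)
    obtain ⟨C, hC⟩ := (hcs.mul_left (f := fun u : ℝ =>
      (((1 + u ^ 2) ^ (((k + 1 : ℕ) : ℝ) / 2 + ε) : ℝ) : ℂ))).exists_bound_of_continuous hcont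
    refine ⟨C * D, fun x => ?_⟩
    have e : (fun v => ethWord w (cut χ a v) x.2) = fun v => c v * ethWord w a.fn x.2 := by
      funext v
      simp [cut, ethWord_smul, c]
    rw [weighted, e, iteratedDeriv_mul_const_field, ← mul_assoc, norm_mul]
    exact mul_le_mul (hC x.1) (hD x.2) (norm_nonneg _) ((norm_nonneg _).trans (hC x.1))
  limTop := by
    obtain ⟨M, -, h⟩ := hχ.eq_off
    refine ⟨r • a, fun R => tendsto_const_nhds.congr' ?_⟩
    filter_upwards [eventually_gt_atTop M] with u hu
    rw [cut, h u hu]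
    rfl
  limBot := by
    obtain ⟨M, h, -⟩ := hχ.eq_off
    refine ⟨l • a, fun R => tendsto_const_nhds.congr' ?_⟩
    filter_upwards [eventually_lt_atBot (-M)] with u hu
    rw [cut, h u hu]
    rfl

variable {ε : ℝ}

/-! ### Asymptotic values of shears, and the constraint as a linear function on phase space. -/

theorem Electric.ext {a b : Electric} (h : ∀ R, a.fn R = b.fn R) : a = b :=
  Subtype.ext (funext h)

theorem Shear.tendsto_plus (f : Shear ε) (R : SO3) :
    Tendsto (fun u => f.fn u R) atTop (𝓝 (f.plus.fn R)) := f.isShear.limTop.choose_spec R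

theorem Shear.tendsto_minus (f : Shear ε) (R : SO3) :
    Tendsto (fun u => f.fn u R) atBot (𝓝 (f.minus.fn R)) := f.isShear.limBot.choose_spec R

theorem Shear.plus_eq {f : Shear ε} {a : Electric}
    (h : ∀ R, Tendsto (fun u => f.fn u R) atTop (𝓝 (a.fn R))) : f.plus = a :=
  Electric.ext fun R => tendsto_nhds_unique (f.tendsto_plus R) (h R)

theorem Shear.minus_eq {f : Shear ε} {a : Electric}
    (h : ∀ R, Tendsto (fun u => f.fn u R) atBot (𝓝 (a.fn R))) : f.minus = a :=
  Electric.ext fun R => tendsto_nhds_unique (f.tendsto_minus R) (h R)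

theorem Shear.plus_add_smul (f g : Shear ε) (t : ℝ) : (f + t • g).plus = f.plus + t • g.plus :=
  Shear.plus_eq fun R => (f.tendsto_plus R).add ((g.tendsto_plus R).const_smul t)

theorem Shear.minus_add_smul (f g : Shear ε) (t : ℝ) :
    (f + t • g).minus = f.minus + t • g.minus :=
  Shear.minus_eq fun R => (f.tendsto_minus R).add ((g.tendsto_minus R).const_smul t)

variable (ε) in
/-- The shear `χ(u) a`. -/
def cutShear {χ : ℝ → ℝ} {l r : ℝ} (hχ : IsCutoff χ l r) (a : Electric) : Shear ε :=
  ⟨cut χ a, isShear_cut ε hχ a⟩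

theorem plus_cutShear {χ : ℝ → ℝ} {l r : ℝ} (hχ : IsCutoff χ l r) (a : Electric) :
    (cutShear ε hχ a).plus = r • a := by
  obtain ⟨M, -, h⟩ := hχ.eq_off
  refine Shear.plus_eq fun R => tendsto_const_nhds.congr' ?_
  filter_upwards [eventually_gt_atTop M] with u hu
  change _ = χ u • a.fn R
  rw [h u hu]
  rfl

theorem minus_cutShear {χ : ℝ → ℝ} {l r : ℝ} (hχ : IsCutoff χ l r) (a : Electric) :
    (cutShear ε hχ a).minus = l • a := by
  obtain ⟨M, h, -⟩ := hχ.eq_off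
  refine Shear.minus_eq fun R => tendsto_const_nhds.congr' ?_
  filter_upwards [eventually_lt_atBot (-M)] with u hu
  change _ = χ u • a.fn R
  rw [h u hu]
  rfl

/-- The `u`-derivative of a shear. -/
def Shear.du (f : Shear ε) : News ε := ⟨AS.du f.fn, f.fn, f.2, rfl⟩

theorem News.scriSmooth (g : News ε) : ScriSmooth g.fn := by
  obtain ⟨f, hf, e⟩ := g.2
  change ScriSmooth g.1
  rw [e]
  exact hf.smooth.du

theorem News.exists_integrable_bound (hε : 0 < ε) (g : News ε) :
    ∃ b : ℝ → ℝ, Integrable b ∧ ∀ u R, ‖g.fn u R‖ ≤ b u := by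
  obtain ⟨f, hf, e⟩ := g.2
  change ∃ b : ℝ → ℝ, Integrable b ∧ ∀ u R, ‖g.1 u R‖ ≤ b u
  rw [e]
  exact hf.exists_integrable_bound hε

/-- The function `N̄ + ∂_u σ` whose vanishing is the constraint. -/
def constraintFn (p : Phase ε) : ScriFun := p.2.fn + du p.1.fn

theorem constraintFn_add_smul (p Y : Phase ε) (t : ℝ) :
    constraintFn (p + t • Y) = constraintFn p + t • constraintFn Y := by
  funext u R
  have h := ((((p.1.isShear.smooth.contDiff R).differentiable (by simp)) u).hasDerivAt.add
    ((((Y.1.isShear.smooth.contDiff R).differentiable (by simp)) u).hasDerivAt.const_smul t)).deriv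
  change p.2.fn u R + t • Y.2.fn u R + _ = (p.2.fn u R + du p.1.fn u R) +
    t • (Y.2.fn u R + du Y.1.fn u R)
  rw [smul_add, add_add_add_comm]
  exact congrArg _ h

theorem constraintFn_scriSmooth (p : Phase ε) : ScriSmooth (constraintFn p) :=
  p.2.scriSmooth.add p.1.isShear.smooth.du

theorem constraintFn_exists_bound (hε : 0 < ε) (p : Phase ε) :
    ∃ b : ℝ → ℝ, Integrable b ∧ ∀ u R, ‖constraintFn p u R‖ ≤ b u := by
  obtain ⟨b, hb, h⟩ := p.2.exists_integrable_bound hε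
  obtain ⟨c, hc, h'⟩ := p.1.isShear.exists_integrable_bound hε
  exact ⟨fun u => b u + c u, hb.add hc, fun u R =>
    (norm_add_le _ _).trans (add_le_add (h u R) (h' u R))⟩

/-- The phase space vector `(σ, -∂_u σ)`, which lies in the constraint surface. -/
def onShellVec (f : Shear ε) : Phase ε := (f, -f.du)

theorem constraintFn_onShellVec (f : Shear ε) : constraintFn (onShellVec f) = 0 :=
  neg_add_cancel (G := ScriFun) (du f.fn)

/-! ## The real pairing of spin-weighted functions on scri -/

/-- The integrand `f̄ g`. -/
def pairFn (f g : ScriFun) (x : ℝ × ℝ × ℝ) : ℂ := (starRingEnd ℂ) (atPoint f x) * atPoint g x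

/-- The pairing `Re ∫ f̄ g`. -/
def pair (f g : ScriFun) : ℝ := (∫ x, pairFn f g x ∂scriMeasure).re

theorem smearedK_eq (φ : ScriFun) (p : Phase ε) :
    smearedK φ p = 1 / (4 * Real.pi) * pair φ (constraintFn p) := rfl

theorem pair_comm (f g : ScriFun) : pair f g = pair g f := by
  have e : pairFn f g = fun x => (starRingEnd ℂ) (pairFn g f x) := by
    funext x
    simp [pairFn, mul_comm]
  rw [pair, e, integral_conj, Complex.conj_re, pair]

theorem integrable_pairFn_comm {f g : ScriFun} (h : Integrable (pairFn f g) scriMeasure) :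
    Integrable (pairFn g f) scriMeasure := by
  have e : pairFn g f = fun x => (starRingEnd ℂ) (pairFn f g x) := by
    funext x
    simp [pairFn, mul_comm]
  rw [e]
  exact Complex.conjCLE.toContinuousLinearMap.integrable_comp h

theorem pair_add {f g h : ScriFun} (hg : Integrable (pairFn f g) scriMeasure)
    (hh : Integrable (pairFn f h) scriMeasure) : pair f (g + h) = pair f g + pair f h := by
  have e : pairFn f (g + h) = fun x => pairFn f g x + pairFn f h x := by
    funext x
    exact mul_add _ _ _
  rw [pair, e, integral_add hg hh, Complex.add_re, pair, pair]

theorem pairFn_smul (f g : ScriFun) (t : ℝ) : pairFn f (t • g) = fun x => t • pairFn f g x := by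
  funext x
  change _ * (t • atPoint g x) = t • (_ * _)
  rw [mul_smul_comm]

theorem pair_smul (f g : ScriFun) (t : ℝ) : pair f (t • g) = t * pair f g := by
  rw [pair, pairFn_smul, integral_smul, Complex.smul_re, smul_eq_mul, pair]

/-- The form is a single integral of a difference; it may be split into two pairings only once both
terms are known to be integrable. -/
theorem Omega_eq {X Y : Phase ε} (h1 : Integrable (pairFn Y.1.fn X.2.fn) scriMeasure)
    (h2 : Integrable (pairFn Y.2.fn X.1.fn) scriMeasure) :
    Omega X Y = 1 / (4 * Real.pi) * (pair Y.1.fn X.2.fn - pair Y.2.fn X.1.fn) := by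
  rw [pair_comm Y.1.fn, pair, pair, ← Complex.sub_re, ← integral_sub (integrable_pairFn_comm h1) h2]
  rfl

theorem Omega_antisymm (X Y : Phase ε) : Omega X Y = -Omega Y X := by
  rw [Omega, Omega, ← mul_neg, ← Complex.neg_re, ← integral_neg]
  simp only [neg_sub]

theorem atPoint_cut_norm_le {χ : ℝ → ℝ} (h1 : ∀ u, |χ u| ≤ 1) {a : Electric} {D : ℝ}
    (hD : ∀ R, ‖a.fn R‖ ≤ D) (x : ℝ × ℝ × ℝ) : ‖atPoint (cut χ a) x‖ ≤ D := by
  rw [atPoint, cut, Pi.smul_apply, norm_smul, Real.norm_eq_abs]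
  exact (mul_le_of_le_one_left (norm_nonneg _) (h1 _)).trans (hD _)

theorem integrable_pairFn_cut {χ : ℝ → ℝ} (hχ : ContDiff ℝ ∞ χ) (h1 : ∀ u, |χ u| ≤ 1)
    (a : Electric) {g : ScriFun} (hg : ScriSmooth g)
    (hb : ∃ b : ℝ → ℝ, Integrable b ∧ ∀ u R, ‖g u R‖ ≤ b u) :
    Integrable (pairFn (cut χ a) g) scriMeasure := by
  obtain ⟨b, hb, hgb⟩ := hb
  obtain ⟨D, hD⟩ := a.sphereSmooth.exists_bound
  refine (hg.integrable_of_bound hb hgb).bdd_mul (c := D)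
    (scriSmooth_cut hχ a).conj.continuous_atPoint.aestronglyMeasurable
    (Eventually.of_forall fun x => ?_)
  change ‖(starRingEnd ℂ) (atPoint (cut χ a) x)‖ ≤ D
  rw [Complex.norm_conj]
  exact atPoint_cut_norm_le h1 hD x

/-- Dominated convergence: the plateaus are bounded by `1` and eventually equal to `1` at each `u`.
This transfers identities known for bounded support to the `u`-independent function `a`, for which
integration by parts would leave boundary terms. -/
theorem tendsto_pair_plateau (a : Electric) {g : ScriFun} (hg : ScriSmooth g)
    (hb : ∃ b : ℝ → ℝ, Integrable b ∧ ∀ u R, ‖g u R‖ ≤ b u) :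
    Tendsto (fun n => pair (cut (plateau n) a) g) atTop (𝓝 (pair (cut (fun _ => 1) a) g)) := by
  refine (Complex.continuous_re.tendsto _).comp ?_
  obtain ⟨b, hb, hgb⟩ := hb
  obtain ⟨D, hD⟩ := a.sphereSmooth.exists_bound
  have hi := hg.integrable_of_bound hb hgb
  refine tendsto_integral_of_dominated_convergence (fun x => D * ‖atPoint g x‖) (fun n => ?_)
    (hi.norm.const_mul D) (fun n => Eventually.of_forall fun x => ?_)
    (Eventually.of_forall fun x => ?_)
  · exact (integrable_pairFn_cut (isCutoff_plateau n).contDiff (abs_plateau_le n) a hg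
      ⟨b, hb, hgb⟩).aestronglyMeasurable
  · rw [pairFn, norm_mul, Complex.norm_conj]
    exact mul_le_mul_of_nonneg_right (atPoint_cut_norm_le (abs_plateau_le n) hD x) (norm_nonneg _)
  · refine tendsto_const_nhds.congr' ?_
    obtain ⟨N, hN⟩ := exists_nat_ge |x.1|
    filter_upwards [eventually_ge_atTop N] with n hn
    have : plateau n x.1 = 1 := plateau_eq_one (hN.trans (by exact_mod_cast hn))
    simp only [pairFn, atPoint, cut, this]

/-- Integration by parts in `u`. -/
theorem pair_cut_du {χ : ℝ → ℝ} (hχ : IsCutoff χ 0 0) (a : Electric) {f : ScriFun}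
    (hf : ScriSmooth f) : Integrable (pairFn (cut (deriv χ) a) f) scriMeasure ∧
      Integrable (pairFn (cut χ a) (du f)) scriMeasure ∧
      pair (cut (deriv χ) a) f = -pair (cut χ a) (du f) := by
  obtain ⟨M, hl, hr⟩ := hχ.eq_off
  obtain ⟨M', hM'⟩ := hχ.deriv_eq_zero
  have hoff : ∀ u ∉ Set.Icc (-M) M, χ u = 0 := fun u hu => by
    rw [Set.mem_Icc, not_and_or, not_le, not_le] at hu
    exact hu.elim (hl u) (hr u)
  have hs := scriSmooth_cut hχ.contDiff a
  have hs' := scriSmooth_cut (contDiff_infty_iff_deriv.1 hχ.contDiff).2 a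
  have h1 : Integrable (pairFn (cut (deriv χ) a) f) scriMeasure :=
    (hs'.conj.mul hf).integrable_of_support (M := M') fun u hu R => by simp [cut, hM' u hu]
  have h2 : Integrable (pairFn (cut χ a) (du f)) scriMeasure :=
    (hs.conj.mul hf.du).integrable_of_support (M := M) fun u hu R => by simp [cut, hoff u hu]
  refine ⟨h1, h2, ?_⟩
  have h := ((hs.conj.mul hf).integral_du_eq_zero (M := M) fun u hu R => by
    simp [cut, hoff u hu]).2
  -- Product rule; the total derivative integrates to zero because the support of `χ` is bounded,
  -- whatever the growth of `f`.
  have e : atPoint (du fun u R => (starRingEnd ℂ) (cut χ a u R) * f u R) =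
      fun x => pairFn (cut (deriv χ) a) f x + pairFn (cut χ a) (du f) x := by
    funext x
    have d1 := ((hχ.contDiff.differentiable (by simp) x.1).hasDerivAt.smul_const
      (a.fn (frame x.2.1 x.2.2))).star
    have d2 := ((hf.contDiff (frame x.2.1 x.2.2)).differentiable (by simp) x.1).hasDerivAt
    exact (d1.mul d2).deriv
  rw [e, integral_add h1 h2] at h
  rw [eq_neg_iff_add_eq_zero, pair, pair, ← Complex.add_re, h, Complex.zero_re]

/-- The news component of the on-shell vector is `-χ' a`; integrating by parts moves the derivative
to the shear component of `X`, so that both terms are paired with the same `χ a`. -/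
theorem Omega_onShellVec_plateau (hε : 0 < ε) (X : Phase ε) (a : Electric) (n : ℕ) :
    Omega X (onShellVec (cutShear ε (isCutoff_plateau n) a)) = 1 / (4 * Real.pi) *
      (pair (cut (plateau n) a) X.2.fn - pair (cut (plateau n) a) (du X.1.fn)) := by
  obtain ⟨h1, h2, h3⟩ := pair_cut_du (isCutoff_plateau n) a X.1.isShear.smooth
  have e : (onShellVec (cutShear ε (isCutoff_plateau n) a)).2.fn =
      (-1 : ℝ) • cut (deriv (plateau n)) a := by
    rw [← du_cut (isCutoff_plateau n).contDiff, neg_one_smul]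
    rfl
  have h4 : pairFn ((-1 : ℝ) • cut (deriv (plateau n)) a) X.1.fn =
      fun x => -pairFn (cut (deriv (plateau n)) a) X.1.fn x := by
    funext x
    simp [pairFn, atPoint]
  rw [Omega_eq, e, pair_comm (_ • _), pair_smul, pair_comm X.1.fn, h3]
  · change _ * (pair (cut (plateau n) a) X.2.fn - _) = _
    ring
  · exact integrable_pairFn_cut (isCutoff_plateau n).contDiff (abs_plateau_le n) a X.2.scriSmooth
      (X.2.exists_integrable_bound hε)
  · rw [e, h4]
    exact h1.neg

theorem isCutoff_one : IsCutoff (fun _ => 1) 1 1 := isCutoff_const 1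

theorem Omega_translation (hε : 0 < ε) (X : Phase ε) (a : Electric) :
    Omega X (cutShear ε isCutoff_one a, 0) =
      1 / (4 * Real.pi) * pair (cut (fun _ => 1) a) X.2.fn := by
  have h : pairFn (0 : News ε).fn X.1.fn = 0 := by
    funext x
    change (starRingEnd ℂ) 0 * _ = 0
    simp
  have h1 : Integrable (pairFn (cut (fun _ => 1) a) X.2.fn) scriMeasure :=
    integrable_pairFn_cut contDiff_const (by simp) a X.2.scriSmooth (X.2.exists_integrable_bound hε)
  have h2 : Integrable (pairFn (0 : News ε).fn X.1.fn) scriMeasure := by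
    rw [h]
    exact integrable_zero _ _ _
  rw [Omega_eq (Y := (cutShear ε isCutoff_one a, 0)) h1 h2]
  change _ * (pair (cut (fun _ => 1) a) X.2.fn - pair (0 : News ε).fn X.1.fn) = _
  rw [pair, pair, h]
  simp

theorem constraintFn_translation (a : Electric) :
    constraintFn ((cutShear ε isCutoff_one a, 0) : Phase ε) = 0 := by
  change (0 : ScriFun) + du (cut (fun _ => 1) a) = 0
  rw [du_cut contDiff_const, zero_add]
  funext u R
  simp [cut]

/-! ## Directional derivatives and the smeared constraints -/

theorem HasDirDeriv.unique {V : Type} [AddCommGroup V] [Module ℝ V] {f : V → ℝ} {x v : V}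
    {w w' : ℝ} (h : HasDirDeriv f x v w) (h' : HasDirDeriv f x v w') : w = w' :=
  tendsto_nhds_unique h h'

theorem hasDirDeriv_of_affine {V : Type} [AddCommGroup V] [Module ℝ V] {f : V → ℝ} {x v : V}
    {w : ℝ} (h : ∀ t : ℝ, f (x + t • v) = f x + t * w) : HasDirDeriv f x v w := by
  refine tendsto_const_nhds.congr' ?_
  filter_upwards [self_mem_nhdsWithin] with t ht
  rw [h, add_sub_cancel_left, smul_eq_mul, inv_mul_cancel_left₀ ht]

theorem isCn_const {W : Type} [AddCommGroup W] [Module ℝ W] [TopologicalSpace W] (n : ℕ) :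
    ∀ {V : Type} [AddCommGroup V] [Module ℝ V] [TopologicalSpace V] (c : W),
      IsCn n fun _ : V => c := by
  induction n with
  | zero => intro V _ _ _ c; exact continuous_const
  | succ n ih =>
    intro V _ _ _ c
    refine ⟨continuous_const, fun _ => 0, fun x v => ?_, ih 0⟩
    simp only [HasDirDeriv, sub_self, smul_zero]
    exact tendsto_const_nhds

theorem isHamiltonianField_hamField {F : Phase ε → ℝ} (h : IsRegular F) :
    IsHamiltonianField F (hamField F) := by
  rw [hamField, dif_pos h]
  exact h.choose_spec

theorem smearedK_add_smul {φ : ScriFun}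
    (hφ : ∀ p : Phase ε, Integrable (constraintIntegrand φ p) scriMeasure) (p Y : Phase ε)
    (t : ℝ) : smearedK φ (p + t • Y) = smearedK φ p + t * smearedK φ Y := by
  have h : Integrable (pairFn φ (t • constraintFn Y)) scriMeasure := by
    rw [pairFn_smul]
    exact (hφ Y).smul t
  rw [smearedK_eq, smearedK_eq, smearedK_eq, constraintFn_add_smul,
    pair_add (g := constraintFn p) (hφ p) h, pair_smul]
  ring

theorem hasDirDeriv_smearedK {φ : ScriFun}
    (hφ : ∀ p : Phase ε, Integrable (constraintIntegrand φ p) scriMeasure) (p Y : Phase ε) :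
    HasDirDeriv (smearedK φ) p Y (smearedK φ Y) :=
  hasDirDeriv_of_affine (smearedK_add_smul hφ p Y)

/-- `smearedK φ` is linear, hence equal to its own derivative. This identity is all that is needed
of the chosen Hamiltonian field, so nondegeneracy of the symplectic form plays no role. -/
theorem Omega_hamField_smearedK {φ : ScriFun} (hφ : φ ∈ regularSmearings ε) (p Y : Phase ε) :
    -Omega (hamField (smearedK φ) p) Y = smearedK φ Y :=
  ((isHamiltonianField_hamField hφ.2.2.2).2 p Y).unique (hasDirDeriv_smearedK hφ.2.2.1 p Y)

theorem smearedK_eq_zero (φ : ScriFun) {Y : Phase ε} (hY : constraintFn Y = 0) :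
    smearedK φ Y = 0 := by
  rw [smearedK_eq, hY]
  simp [pair, pairFn, atPoint]

/-- The constant field `(χ a, χ' a)` generates the constraint smeared with `χ a`: integration by
parts turns `-⟨χ' a, Y_σ⟩` into `⟨χ a, ∂_u Y_σ⟩`. Being constant, it is smooth. -/
theorem cut_plateau_mem_regularSmearings (hε : 0 < ε) (a : Electric) (n : ℕ) :
    cut (plateau n) a ∈ regularSmearings ε := by
  have hχ := isCutoff_plateau n
  have hint : ∀ p : Phase ε,
      Integrable (constraintIntegrand (cut (plateau n) a) p) scriMeasure := fun p =>
    integrable_pairFn_cut hχ.contDiff (abs_plateau_le n) a (constraintFn_scriSmooth p)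
      (constraintFn_exists_bound hε p)
  refine ⟨scriSmooth_cut hχ.contDiff a, hasSpin_cut _ a, hint,
    fun _ => (cutShear ε hχ a, (cutShear ε hχ a).du), fun m => isCn_const m _, fun p Y => ?_⟩
  have e : (cutShear ε hχ a).du.fn = cut (deriv (plateau n)) a := du_cut hχ.contDiff a
  obtain ⟨h1, h2, h3⟩ := pair_cut_du hχ a Y.1.isShear.smooth
  have h4 : Integrable (pairFn (cut (plateau n) a) Y.2.fn) scriMeasure :=
    integrable_pairFn_cut hχ.contDiff (abs_plateau_le n) a Y.2.scriSmooth
      (Y.2.exists_integrable_bound hε)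
  convert hasDirDeriv_smearedK hint p Y using 1
  rw [Omega_antisymm, neg_neg, Omega_eq (Y := (cutShear ε hχ a, (cutShear ε hχ a).du)) h4
    (by rw [e]; exact h1), e, h3, sub_neg_eq_add,
    smearedK_eq, constraintFn, pair_add h4 h2]
  rfl

/-! ## Proper observables are invariant under translations of the shear -/

theorem add_smul_mem_onShell {p Y : Phase ε} (hp : p ∈ onShell ε) (hY : constraintFn Y = 0)
    (t : ℝ) : p + t • Y ∈ onShell ε := by
  change constraintFn (p + t • Y) = 0
  rw [constraintFn_add_smul, hY, smul_zero, add_zero]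
  exact hp

/-- The two components of a phase space vector which is symplectically orthogonal to the on-shell
vectors of bounded support have the same pairing with `u`-independent electric functions. -/
theorem pair_news_eq_pair_du (hε : 0 < ε) {X : Phase ε} {a : Electric}
    (h : ∀ n, Omega X (onShellVec (cutShear ε (isCutoff_plateau n) a)) = 0) :
    pair (cut (fun _ => 1) a) X.2.fn = pair (cut (fun _ => 1) a) (du X.1.fn) := by
  have h' : ∀ n, pair (cut (plateau n) a) X.2.fn = pair (cut (plateau n) a) (du X.1.fn) := by
    intro n
    have := h n
    rw [Omega_onShellVec_plateau hε] at this
    exact sub_eq_zero.1 ((mul_eq_zero.1 this).resolve_left (by positivity))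
  refine tendsto_nhds_unique
    (tendsto_pair_plateau a X.2.scriSmooth (X.2.exists_integrable_bound hε)) ?_
  simp only [h']
  exact tendsto_pair_plateau a X.1.isShear.smooth.du (X.1.isShear.exists_integrable_bound hε)

theorem hasDirDeriv_translation (hε : 0 < ε) {F : Phase ε → ℝ} (hF : IsTangentiallyExtensible F)
    {Θ : Electric × Electric → ℝ} (hΘ : DirectlyMeasures F Θ) {p : Phase ε} (hp : p ∈ onShell ε)
    (a : Electric) : HasDirDeriv F p (cutShear ε isCutoff_one a, 0) 0 := by
  obtain ⟨hreg, φ, hφ, hext⟩ := hF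
  have hX := (isHamiltonianField_hamField hreg).2 p
  have hH := Omega_hamField_smearedK (hφ p) p
  set X := hamField F p
  set H := hamField (smearedK (φ p)) p
  -- A plateau has limits `0` at both ends, so `F` is constant along this on-shell line and its
  -- derivative vanishes.
  have hX0 := pair_news_eq_pair_du hε (X := X) (a := a) fun n => by
    refine neg_eq_zero.1 ((hX _).unique (hasDirDeriv_of_affine fun t => ?_))
    rw [hΘ _ (add_smul_mem_onShell hp (constraintFn_onShellVec _) t), hΘ _ hp, mul_zero, add_zero]
    change Θ ((p.1 + t • cutShear ε (isCutoff_plateau n) a).plus,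
      (p.1 + t • cutShear ε (isCutoff_plateau n) a).minus) = _
    rw [Shear.plus_add_smul, Shear.minus_add_smul, plus_cutShear, minus_cutShear]
    simp
  have hH0 := pair_news_eq_pair_du hε (X := H) (a := a) fun n => by
    rw [← neg_eq_zero, hH]
    exact smearedK_eq_zero _ (constraintFn_onShellVec _)
  -- The constraint smeared with `φ p` does not change under the translation `(a, 0)`, which
  -- satisfies the linear constraint.
  have hH1 : pair (cut (fun _ => 1) a) H.2.fn = 0 := by
    have := hH (cutShear ε isCutoff_one a, 0)
    rw [smearedK_eq_zero _ (constraintFn_translation a), Omega_translation hε, neg_eq_zero] at this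
    exact (mul_eq_zero.1 this).resolve_left (by positivity)
  -- Extensibility tested with `φ' = χ_n a`. By antisymmetry, a bracket with `K_φ'` is minus the
  -- value of `K_φ'` on the other Hamiltonian vector.
  have hsum : ∀ n, pair (cut (plateau n) a) (constraintFn H) +
      pair (cut (plateau n) a) (constraintFn X) = 0 := by
    intro n
    have hK := cut_plateau_mem_regularSmearings hε a n
    have h := hext p hp _ hK
    have e : ∀ Z, Omega Z (hamField (smearedK (cut (plateau n) a)) p) =
        smearedK (cut (plateau n) a) Z := fun Z => by
      rw [Omega_antisymm, Omega_hamField_smearedK hK]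
    rw [poisson, poisson, e, e, smearedK_eq, smearedK_eq, neg_neg, neg_eq_iff_add_eq_zero,
      ← mul_add] at h
    exact (mul_eq_zero.1 h).resolve_left (by positivity)
  have hlim : pair (cut (fun _ => 1) a) (constraintFn H) +
      pair (cut (fun _ => 1) a) (constraintFn X) = 0 := by
    refine tendsto_nhds_unique (((tendsto_pair_plateau a (constraintFn_scriSmooth H)
      (constraintFn_exists_bound hε H)).add (tendsto_pair_plateau a (constraintFn_scriSmooth X)
      (constraintFn_exists_bound hε X))).congr hsum) tendsto_const_nhds
  have hsplit : ∀ Z : Phase ε, pair (cut (fun _ => 1) a) (constraintFn Z) =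
      pair (cut (fun _ => 1) a) Z.2.fn + pair (cut (fun _ => 1) a) (du Z.1.fn) := fun Z =>
    pair_add
      (integrable_pairFn_cut contDiff_const (by simp) a Z.2.scriSmooth
        (Z.2.exists_integrable_bound hε))
      (integrable_pairFn_cut contDiff_const (by simp) a Z.1.isShear.smooth.du
        (Z.1.isShear.exists_integrable_bound hε))
  rw [hsplit, hsplit] at hlim
  -- Both terms of `H` vanish and the two terms of `X` are equal, so twice this pairing is zero.
  have h0 : pair (cut (fun _ => 1) a) X.2.fn = 0 := by linarith
  convert hX _ using 1
  rw [Omega_translation hε, h0, mul_zero, neg_zero]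

theorem apply_add_translation (hε : 0 < ε) {F : Phase ε → ℝ} (hF : IsTangentiallyExtensible F)
    {Θ : Electric × Electric → ℝ} (hΘ : DirectlyMeasures F Θ) {p : Phase ε} (hp : p ∈ onShell ε)
    (a : Electric) : F (p + (cutShear ε isCutoff_one a, 0)) = F p := by
  set Y : Phase ε := (cutShear ε isCutoff_one a, 0)
  -- The whole line stays on shell, so the infinitesimal invariance applies at each of its points.
  have hd : ∀ t : ℝ, HasDerivAt (fun t : ℝ => F (p + t • Y)) 0 t := fun t => by
    have := hasDirDeriv_translation hε hF hΘ
      (add_smul_mem_onShell hp (constraintFn_translation a) t) a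
    rw [hasDerivAt_iff_tendsto_slope_zero]
    simpa only [HasDirDeriv, add_assoc, ← add_smul] using this
  have := is_const_of_deriv_eq_zero (fun t => (hd t).differentiableAt) (fun t => (hd t).deriv) 1 0
  simpa using this

/-- A functional of the asymptotic shears measured by a proper observable is invariant under
simultaneous translations of both shears. -/
theorem DirectlyMeasures.translation_invariant (hε : 0 < ε) {F : Phase ε → ℝ}
    (hF : IsTangentiallyExtensible F) {Θ : Electric × Electric → ℝ} (hΘ : DirectlyMeasures F Θ)
    (a b c : Electric) : Θ (a + c, b + c) = Θ (a, b) := by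
  -- An interpolating shear with limit `b` at `-∞` and `b + (a - b) = a` at `+∞`.
  set σ : Shear ε := cutShear ε isCutoff_one b +
    (1 : ℝ) • cutShear ε isCutoff_smoothTransition (a - b)
  have hp : onShellVec σ ∈ onShell ε := constraintFn_onShellVec σ
  have hplus : σ.plus = a := by
    rw [Shear.plus_add_smul, plus_cutShear, plus_cutShear]
    simp
  have hminus : σ.minus = b := by
    rw [Shear.minus_add_smul, minus_cutShear, minus_cutShear]
    simp
  have h := apply_add_translation hε hF hΘ hp c
  have hq := add_smul_mem_onShell hp (constraintFn_translation (ε := ε) c) 1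
  rw [← one_smul ℝ ((cutShear ε isCutoff_one c, 0) : Phase ε), hΘ _ hq, hΘ _ hp] at h
  change Θ ((σ + (1 : ℝ) • cutShear ε isCutoff_one c).plus,
    (σ + (1 : ℝ) • cutShear ε isCutoff_one c).minus) = Θ (σ.plus, σ.minus) at h
  rw [Shear.plus_add_smul, Shear.minus_add_smul, plus_cutShear, minus_cutShear, hplus, hminus] at h
  simpa using h

/-- The derivative of `f ∘ L` is `f' ∘ (L × L)`, again a composite with a continuous linear map but
on larger spaces; hence the induction quantifies over the spaces. It gives smoothness of the
restriction of `Θ` to `b = 0`. -/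
theorem IsCn.comp_continuousLinearMap {W : Type} [AddCommGroup W] [Module ℝ W]
    [TopologicalSpace W] (n : ℕ) :
    ∀ {U V : Type} [AddCommGroup U] [Module ℝ U] [TopologicalSpace U]
      [AddCommGroup V] [Module ℝ V] [TopologicalSpace V] {f : V → W}, IsCn n f →
      ∀ L : U →L[ℝ] V, IsCn n fun x => f (L x) := by
  induction n with
  | zero =>
    intro U V _ _ _ _ _ _ f hf L
    exact Continuous.comp hf L.continuous
  | succ n ih =>
    intro U V _ _ _ _ _ _ f hf L
    obtain ⟨hc, f', hf', h⟩ := hf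
    refine ⟨hc.comp L.continuous, fun x => f' (L x.1, L x.2), fun x v => ?_, ih h (L.prodMap L)⟩
    have := hf' (L x) (L v)
    simpa only [HasDirDeriv, map_add, map_smul] using this

end AS

end

theorem theorem1 (ε : ℝ) (hε : 0 < ε) :
    (∀ (Θ : AS.Electric × AS.Electric → ℝ), AS.IsSmooth Θ →
      ∀ F : AS.Phase ε → ℝ, AS.IsProperObservable F → AS.DirectlyMeasures F Θ →
        ∃ θ : AS.Electric → ℝ, AS.IsSmooth θ ∧ ∀ a b, Θ (a, b) = θ (a - b)) ∧
    (∀ (G : AS.Electric → ℝ) (F : AS.Phase ε → ℝ), AS.IsProperObservable F →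
      AS.DirectlyMeasures F (fun s => G (s.1 + s.2)) → ∃ c, ∀ s, G s = c) := by
  constructor
  · intro Θ hs F hF hΘ
    -- Invariance shifts `(a - b, 0)` by `b` to `(a, b)`.
    refine ⟨fun x => Θ (x, 0), fun n => (hs n).comp_continuousLinearMap n
      (ContinuousLinearMap.inl ℝ AS.Electric AS.Electric), fun a b => ?_⟩
    simpa using hΘ.translation_invariant hε hF.2 (a - b) 0 b
  · intro G F hF hG
    refine ⟨G 0, fun s => ?_⟩
    -- Shifting both limits by `s / 2` moves their sum from `0` to `s`.
    have h := hG.translation_invariant hε hF.2 0 0 ((1 / 2 : ℝ) • s)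
    simp only [zero_add, ← add_smul] at h
    norm_num at h
    exact h
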